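/- Let $d\ge 3$, $m\ge 1$, $X=\{0,\dots,d-1\}$, $B=(\mathbb Z/d\mathbb Z)^m$. Let $a$ be the automorphism of the $d$-ary rooted tree $X^*$ given by $a(v_0v_1\dots v_n)=(v_0+1)v_1\dots v_n$ (addition modulo $d$), and $A=\langle a\rangle\cong\mathbb Z/d\mathbb Z$. Let $\omega=(\omega_n)_{n\ge 0}$ be a sequence of epimorphisms $\omega_n:B\to A$ with $\bigcap_{j\ge i}\ker\omega_j=1$ for all $i\ge 0$. For $b\in B$ let $b_\omega$ be the tree automorphism with $b_\omega\big((d-1)^r0\,v_{r+1}v_{r+2}\dots v_n\big)=(d-1)^r0\,\omega_r(b)(v_{r+1})\,v_{r+2}\dots v_n$ for $r\ge0$, which fixes every word that has no prefix of the form $(d-1)^r0$. Put $B_\omega=\langle b_\omega\mid b\in B\rangle$, $G=\langle A,B_\omega\rangle$ and $S=(A\cup B_\omega)\setminus\{1\}$, and let $G$ act on the space $X^{\mathbb N}$ of infinite words in the natural way. For $\xi\in X^{\mathbb N}$ let $\Gamma_\xi$ be the Schreier graph with vertex set $G\cdot\xi$ and one edge from $y$ to $sy$ for every $s\in S$ and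 $y\in G\cdot\xi$, regarded as an unrooted, undirected, unlabeled multigraph (loops and multiple edges are kept). Let $\mu$ be the uniform Bernoulli measure on $X^{\mathbb N}$. Call $\xi,\eta\in X^{\mathbb N}$ compatible if $\xi=w_00w_10\dots$ and $\eta=\tilde w_00\tilde w_10\dots$, where the $w_k,\tilde w_k$ are (finite or infinite) words without zeros such that, for every $k$, $|w_k|=|\tilde w_k|$ and, if this length is finite, the maximal suffixes of the form $(d-1)^r$ of $w_k$ and $\tilde w_k$ have the same length $r$. Let $\mathrm{Comp}(\xi)$ be the set of all $\eta$ compatible with $\xi$. Then $G$ is countable, every $g\in G$ preserves $\mu$, and for every $\xi\in X^{\mathbb N}$ $$\{\eta\in X^{\mathbb N}\mid \Gamma_\eta\cong\Gamma_\xi\}=\bigcup_{g\in G}\mathrm{Comp}(g\xi)\qquad\text{and}\qquad \mu\big(\{\eta\in X^{\mathbb N}\mid \Gamma_\eta\cong\Gamma_\xi\}\big)=0 .$$ -/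

import Mathlib

open MeasureTheory ProbabilityTheory

noncomputable section

namespace Spinal

/-! ### Automorphisms of the rooted tree of finite words and their action on infinite words -/

/-- The group of automorphisms of the infinite rooted tree whose vertices are the finite words
over the alphabet `X`, the root being the empty word and the children of `v` being the words `vi`,
`i ∈ X`: the permutations of the set of words that preserve levels and the prefix relation. -/
def TreeAut (X : Type) : Subgroup (Equiv.Perm (List X)) where
  carrier := {g | (∀ w, (g w).length = w.length) ∧ ∀ u v, u <+: v → g u <+: g v}
  one_mem' := ⟨fun _ => rfl, fun _ _ h => h⟩
  mul_mem' := by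
    rintro g h ⟨g1, g2⟩ ⟨h1, h2⟩
    exact ⟨fun w => by simp [g1, h1], fun u v huv => by simpa using g2 _ _ (h2 _ _ huv)⟩
  inv_mem' := by
    rintro g ⟨g1, g2⟩
    have hl : ∀ w, (g⁻¹ w).length = w.length := fun w => by
      have := g1 (g⁻¹ w)
      simpa using this.symm
    refine ⟨hl, fun u v huv => ?_⟩
    have hp : (g⁻¹ v).take u.length <+: g⁻¹ v := List.take_prefix _ _
    have hgp := g2 _ _ hp
    rw [show g (g⁻¹ v) = v from Equiv.apply_symm_apply g v] at hgp
    have hlen : (g ((g⁻¹ v).take u.length)).length = u.length := by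
      rw [g1, List.length_take, hl]
      exact min_eq_left huv.length_le
    have hu : g ((g⁻¹ v).take u.length) = u :=
      (List.prefix_of_prefix_length_le hgp huv hlen.le).eq_of_length hlen
    have : (g⁻¹ v).take u.length = g⁻¹ u := by
      exact (Equiv.symm_apply_apply g _).symm.trans (congrArg (⇑g⁻¹) hu)
    rw [← this]
    exact hp

/-- The word formed by the first `n` letters of the infinite word `ξ`. -/
def pre {X : Type} (ξ : ℕ → X) (n : ℕ) : List X := List.ofFn fun i : Fin n => ξ i

theorem length_apply_pre {X : Type} (g : TreeAut X) (ξ : ℕ → X) (n : ℕ) :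
    (g.1 (pre ξ n)).length = n := by
  rw [g.2.1]; simp [pre]

theorem pre_prefix {X : Type} (ξ : ℕ → X) {m n : ℕ} (h : m ≤ n) : pre ξ m <+: pre ξ n := by
  rw [List.prefix_iff_eq_take]
  apply List.ext_getElem
  · simp [pre, h]
  · intro i h1 h2
    simp [pre]

/-- The action of a tree automorphism on infinite words: the letter of index `n` of `g ξ` is the
last letter of the image under `g` of the prefix of length `n + 1` of `ξ`. -/
def boundaryMap {X : Type} (g : TreeAut X) (ξ : ℕ → X) : ℕ → X :=
  fun n => (g.1 (pre ξ (n + 1)))[n]'(by rw [length_apply_pre]; exact n.lt_succ_self)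

/-- `g ξ` is the infinite word whose prefixes are the images under `g` of the prefixes of `ξ`. -/
theorem pre_boundaryMap {X : Type} (g : TreeAut X) (ξ : ℕ → X) (n : ℕ) :
    pre (boundaryMap g ξ) n = g.1 (pre ξ n) := by
  apply List.ext_getElem
  · rw [length_apply_pre]; simp [pre]
  · intro i h1 h2
    have hi : i < n := by simpa [pre] using h1
    have hp : g.1 (pre ξ (i + 1)) <+: g.1 (pre ξ n) := g.2.2 _ _ (pre_prefix ξ hi)
    have := hp.getElem (i := i) (by rw [length_apply_pre]; exact i.lt_succ_self)
    rw [← this]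
    simp [pre, boundaryMap]

theorem eq_of_pre_eq {X : Type} {ξ η : ℕ → X} (h : ∀ n, pre ξ n = pre η n) : ξ = η := by
  funext n
  have h1 := h (n + 1)
  simp only [pre, List.ofFn_inj] at h1
  exact congrFun h1 (Fin.last n)

instance boundaryAction (X : Type) : MulAction (TreeAut X) (ℕ → X) where
  smul := boundaryMap
  one_smul ξ := eq_of_pre_eq fun n => pre_boundaryMap 1 ξ n
  mul_smul g h ξ := eq_of_pre_eq fun n => by
    change pre (boundaryMap (g * h) ξ) n = pre (boundaryMap g (boundaryMap h ξ)) n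
    rw [pre_boundaryMap, pre_boundaryMap, pre_boundaryMap]
    rfl

/-! ### Spinal groups

The alphabet is `X = {0, …, d-1}`, written as `ZMod d`; its last letter `d-1` is `-1 : ZMod d`. -/

/-- Addition of `j` modulo `d` to the first letter of a word. -/
def rotWord {d : ℕ} (j : ZMod d) : List (ZMod d) → List (ZMod d)
  | [] => []
  | x :: w => (x + j) :: w

/-- Given `c = (c₀, c₁, …)`, the map that adds `c_r` to the letter following the prefix
`(d-1)^r 0`, for words having such a prefix, and that fixes all other words. -/
def spineWord {d : ℕ} : (ℕ → ZMod d) → List (ZMod d) → List (ZMod d)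
  | _, [] => []
  | c, x :: w =>
    if x = 0 then x :: rotWord (c 0) w
    else if x = -1 then x :: spineWord (fun n => c (n + 1)) w
    else x :: w

theorem rotWord_rotWord {d : ℕ} (i j : ZMod d) (h : i + j = 0) (w : List (ZMod d)) :
    rotWord i (rotWord j w) = w := by
  cases w with
  | nil => rfl
  | cons x w => simp [rotWord, add_assoc, add_comm j i, h]

theorem spineWord_spineWord {d : ℕ} (w : List (ZMod d)) :
    ∀ c e : ℕ → ZMod d, (∀ n, c n + e n = 0) → spineWord c (spineWord e w) = w := by
  induction w with
  | nil => intro c e _; rfl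
  | cons x w ih =>
    intro c e h
    by_cases h0 : x = 0
    · simp [spineWord, h0, rotWord_rotWord _ _ (h 0)]
    · by_cases h1 : x = -1
      · have := ih (fun n => c (n + 1)) (fun n => e (n + 1)) (fun n => h _)
        subst h1
        simp only [spineWord, if_neg h0, if_true, this]
      · simp [spineWord, h0, h1]

theorem length_rotWord {d : ℕ} (j : ZMod d) (w : List (ZMod d)) :
    (rotWord j w).length = w.length := by
  cases w <;> rfl

theorem rotWord_prefix {d : ℕ} (j : ZMod d) (u v : List (ZMod d)) (h : u <+: v) :
    rotWord j u <+: rotWord j v := by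
  obtain ⟨t, rfl⟩ := h
  cases u with
  | nil => exact List.nil_prefix
  | cons x u => exact ⟨t, rfl⟩

theorem length_spineWord {d : ℕ} (w : List (ZMod d)) :
    ∀ c : ℕ → ZMod d, (spineWord c w).length = w.length := by
  induction w with
  | nil => intro c; rfl
  | cons x w ih =>
    intro c
    simp only [spineWord]
    split_ifs <;> simp [length_rotWord, ih]

theorem spineWord_prefix {d : ℕ} (u : List (ZMod d)) :
    ∀ (c : ℕ → ZMod d) (v : List (ZMod d)), u <+: v → spineWord c u <+: spineWord c v := by
  induction u with
  | nil => intro c v _; exact List.nil_prefix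
  | cons x u ih =>
    intro c v h
    obtain ⟨t, rfl⟩ := h
    simp only [spineWord, List.cons_append]
    split_ifs
    · exact List.cons_prefix_cons.2 ⟨rfl, rotWord_prefix _ _ _ ⟨t, rfl⟩⟩
    · exact List.cons_prefix_cons.2 ⟨rfl, ih _ _ ⟨t, rfl⟩⟩
    · exact ⟨t, rfl⟩

/-- The rooted automorphism `a`, `a(v₀ v₁ … v_n) = (v₀ + 1) v₁ … v_n`. -/
def rooted (d : ℕ) : TreeAut (ZMod d) :=
  ⟨⟨rotWord 1, rotWord (-1), rotWord_rotWord _ _ (by simp), rotWord_rotWord _ _ (by simp)⟩,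
    length_rotWord 1, rotWord_prefix 1⟩

/-- The spinal automorphism that maps `(d-1)^r 0 v_{r+1} v_{r+2} … v_n` to
`(d-1)^r 0 (v_{r+1} + c_r) v_{r+2} … v_n` and fixes all words without a prefix `(d-1)^r 0`. -/
def spine {d : ℕ} (c : ℕ → ZMod d) : TreeAut (ZMod d) :=
  ⟨⟨spineWord c, spineWord (-c),
      fun w => spineWord_spineWord w _ _ (by simp),
      fun w => spineWord_spineWord w _ _ (by simp)⟩,
    fun w => length_spineWord w c, fun u v h => spineWord_prefix u c v h⟩

/-- A sequence of homomorphisms from `B = (ℤ/dℤ)^m` to `A = ⟨a⟩`, where `a^j ∈ A` is written as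
`j ∈ ℤ/dℤ`. -/
abbrev HomSeq (d m : ℕ) : Type := ℕ → ((Fin m → ZMod d) →+ ZMod d)

/-- The set `Ω_{d,m}` of sequences of epimorphisms all of whose tails have kernels with trivial
intersection. -/
def Omega (d m : ℕ) : Set (HomSeq d m) :=
  {ω | (∀ n, Function.Surjective (ω n)) ∧ ∀ i, (⨅ j ≥ i, (ω j).ker) = ⊥}

/-- The group `A = ⟨a⟩`. -/
def groupA (d : ℕ) : Subgroup (TreeAut (ZMod d)) := Subgroup.zpowers (rooted d)

/-- The group `B_ω` generated by the spinal automorphisms `b_ω`, `b ∈ B`. -/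
def groupB {d m : ℕ} (ω : HomSeq d m) : Subgroup (TreeAut (ZMod d)) :=
  Subgroup.closure (Set.range fun b : Fin m → ZMod d => spine fun n => ω n b)

/-- The spinal group `G_ω = ⟨A, B_ω⟩`. -/
def spinalGroup {d m : ℕ} (ω : HomSeq d m) : Subgroup (TreeAut (ZMod d)) := groupA d ⊔ groupB ω

/-- The spinal generating set `S_ω = (A ∪ B_ω) \ {1}`. -/
def spinalGens {d m : ℕ} (ω : HomSeq d m) : Set (TreeAut (ZMod d)) :=
  ((groupA d : Set (TreeAut (ZMod d))) ∪ groupB ω) \ {1}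

theorem spinalGens_subset {d m : ℕ} (ω : HomSeq d m) :
    spinalGens ω ⊆ (spinalGroup ω : Set (TreeAut (ZMod d))) := by
  rintro s ⟨hs | hs, -⟩
  · exact (le_sup_left : groupA d ≤ groupA d ⊔ groupB ω) hs
  · exact (le_sup_right : groupB ω ≤ groupA d ⊔ groupB ω) hs

/-! ### Schreier graphs -/

/-- The orbital Schreier graph of the point `ξ`, unrooted, undirected and unlabeled. Its vertices
are the points of the orbit of `ξ`; for every `s ∈ S` and every vertex `y` there is one edge,
named `(s, y)`, with ends `y` and `s y`. Loops and multiple edges are kept. -/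
def schreierGraph {G Y : Type} [Group G] [MulAction G Y] (H : Subgroup G) (S : Set G)
    (hS : S ⊆ (H : Set G)) (ξ : Y) : Graph Y (G × Y) where
  vertexSet := MulAction.orbit H ξ
  IsLink e u v := e.1 ∈ S ∧ e.2 ∈ MulAction.orbit H ξ ∧
    ((u = e.2 ∧ v = e.1 • e.2) ∨ (v = e.2 ∧ u = e.1 • e.2))
  isLink_symm _ _ := ⟨fun _ _ h => ⟨h.1, h.2.1, h.2.2.symm⟩⟩
  eq_or_eq_of_isLink_of_isLink := by
    rintro e x y v w ⟨-, -, h⟩ ⟨-, -, h'⟩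
    rcases h with ⟨rfl, rfl⟩ | ⟨rfl, rfl⟩ <;> rcases h' with ⟨rfl, rfl⟩ | ⟨rfl, rfl⟩ <;> simp
  left_mem_of_isLink := by
    rintro e x y ⟨hs, hy, ⟨rfl, -⟩ | ⟨-, rfl⟩⟩
    · exact hy
    · obtain ⟨h, hh⟩ := hy
      refine ⟨⟨e.1, hS hs⟩ * h, ?_⟩
      rw [← hh]
      exact mul_smul e.1 (h : G) ξ

/-- Isomorphism of multigraphs: a bijection between the vertices together with a bijection
between the edges that respects the ends of the edges. -/
def GraphIsomorphic {V E V' E' : Type} (Γ : Graph V E) (Γ' : Graph V' E') : Prop :=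
  ∃ (f : Γ.vertexSet ≃ Γ'.vertexSet) (k : Γ.edgeSet ≃ Γ'.edgeSet),
    ∀ (e : Γ.edgeSet) (u v : Γ.vertexSet), Γ.IsLink e u v ↔ Γ'.IsLink (k e) (f u) (f v)

/-- The graph `Γ_ξ` of the spinal group `G_ω` with respect to `S_ω`, without root, orientation
and labels. -/
def boundaryGraph {d m : ℕ} (ω : HomSeq d m) (ξ : ℕ → ZMod d) :
    Graph (ℕ → ZMod d) (TreeAut (ZMod d) × (ℕ → ZMod d)) :=
  schreierGraph (spinalGroup ω) (spinalGens ω) (spinalGens_subset ω) ξ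

/-- The unrooted, unlabeled isomorphism class of `ξ`: all `η` with `Γ_η` isomorphic to `Γ_ξ`. -/
def isoClass {d m : ℕ} (ω : HomSeq d m) (ξ : ℕ → ZMod d) : Set (ℕ → ZMod d) :=
  {η | GraphIsomorphic (boundaryGraph ω η) (boundaryGraph ω ξ)}

/-! ### Compatibility -/

/-- `w` is a word without zeros whose maximal suffix of letters `d-1` has length `r`. -/
def InY {d : ℕ} (r : ℕ) (w : List (ZMod d)) : Prop :=
  (∀ x ∈ w, x ≠ 0) ∧ ∃ u, w = u ++ List.replicate r (-1) ∧ ∀ x ∈ u.getLast?, x ≠ -1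

/-- The subword `ξ_s … ξ_{s+l-1}` of `ξ` is one of the finite words `w_k` in the decomposition
`ξ = w₀ 0 w₁ 0 …`, where the `w_k` contain no zeros. -/
def IsBlock {d : ℕ} (ξ : ℕ → ZMod d) (s l : ℕ) : Prop :=
  (s = 0 ∨ ξ (s - 1) = 0) ∧ (∀ i < l, ξ (s + i) ≠ 0) ∧ ξ (s + l) = 0

/-- Compatibility of `ξ = w₀ 0 w₁ 0 …` and `η = w'₀ 0 w'₁ 0 …`: the zeros are at the same
positions, and for every `k` with `w_k` finite the maximal suffixes of letters `d-1` of `w_k` and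
`w'_k` have the same length. -/
def Compatible {d : ℕ} (ξ η : ℕ → ZMod d) : Prop :=
  (∀ n, ξ n = 0 ↔ η n = 0) ∧
    ∀ s l, IsBlock ξ s l → ∀ r,
      (InY r (pre (fun i => ξ (s + i)) l) ↔ InY r (pre (fun i => η (s + i)) l))

/-- The compatibility class of `ξ`. -/
def compClass {d : ℕ} (ξ : ℕ → ZMod d) : Set (ℕ → ZMod d) := {η | Compatible ξ η}

/-- The uniform Bernoulli measure on the space of infinite words. -/
def bernoulliMeasure (d : ℕ) [NeZero d] : Measure (ℕ → ZMod d) :=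
  Measure.infinitePi fun _ : ℕ => uniformOn (Set.univ : Set (ZMod d))

end Spinal

end

/-! Write `-1` for the letter `d-1`. The group `A` moves a word exactly through its root tile, the
words that differ from it at most in the first letter. If a word begins with `(d-1)^r 0`, then `B_ω`
moves it exactly through its spine tile, where only the next letter varies, because `ω_r` is onto;
all other words are fixed by `B_ω`. Up to loops and multiplicities a Schreier graph is therefore a
union of cliques of two kinds. Every vertex lies in one root tile and at most one spine tile, and
tiles of different kinds share at most one vertex. Compatibility says that zeros, and shifts with a
prefix `(d-1)^r 0`, occur at the same positions (`compatible_iff_sameSpines`).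

An isomorphism forces compatibility because adjacency alone determines the tiles. A vertex is off
the spine exactly when its neighbours are pairwise adjacent (`onSpine_iff_tileAdj`), its closed
neighbourhood is then a root tile, and every root tile contains such a vertex. The tiles in turn
reveal whether the first letter is `0` (`apply_zero_eq_zero_iff`). They are also self-similar: after
a first letter `0` spine tiles become root tiles of the tail, and after `-1` they become spine tiles
of the tail. A partial bijection respecting tiles thus induces one on tails
(`TileBisimulation.tailRel`), and iteration reads off all positions.

Conversely, if `η` and `ζ` are compatible, `transport` swaps `η n` and `ζ n` at position `n` of each
word that agrees with `η` beyond `n`. It preserves spine prefixes and permutes the varying letter of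
each tile. Such permutations lift through `ω_r` to `B`, because all fibres of `ω_r` are cosets of
its kernel; hence loops and multiple edges match (`exists_gens_perm`).

Compatible words have the same zeros, an event of probability at most `max (1/d) (1 - 1/d)` for each
letter independently, so compatibility classes are null. The group is an image of a free product of
two finite groups, so the union over it is countable. -/

namespace Spinal

/-! ### Infinite words with a prefix `(d-1)^r 0` -/

section Words

variable {d : ℕ}

/-- The infinite word `y` begins with `(d-1)^r 0`. -/
def SpinePrefix (r : ℕ) (y : ℕ → ZMod d) : Prop := (∀ i < r, y i = -1) ∧ y r = 0

/-- The infinite word `y` has a prefix of the form `(d-1)^r 0`. -/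
def OnSpine (y : ℕ → ZMod d) : Prop := ∃ r, SpinePrefix r y

/-- The infinite word `y` without its first `n` letters. -/
def shift (n : ℕ) (y : ℕ → ZMod d) : ℕ → ZMod d := fun k => y (n + k)

/-- The infinite word with first letter `x`, followed by `y`. -/
def consWord (x : ZMod d) (y : ℕ → ZMod d) : ℕ → ZMod d
  | 0 => x
  | n + 1 => y n

@[simp] theorem consWord_zero (x : ZMod d) (y : ℕ → ZMod d) : consWord x y 0 = x := rfl

@[simp] theorem consWord_succ (x : ZMod d) (y : ℕ → ZMod d) (n : ℕ) :
    consWord x y (n + 1) = y n := rfl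

@[simp] theorem shift_apply (n k : ℕ) (y : ℕ → ZMod d) : shift n y k = y (n + k) := rfl

theorem shift_shift (m n : ℕ) (y : ℕ → ZMod d) : shift m (shift n y) = shift (n + m) y := by
  funext k; simp [add_assoc]

@[simp] theorem shift_zero (y : ℕ → ZMod d) : shift 0 y = y := by
  funext k; simp

theorem consWord_shift_one (y : ℕ → ZMod d) : consWord (y 0) (shift 1 y) = y := by
  funext k; cases k <;> simp [add_comm]

theorem shift_one_consWord (x : ZMod d) (y : ℕ → ZMod d) : shift 1 (consWord x y) = y := by
  funext k; simp [add_comm 1 k]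

theorem pre_zero (y : ℕ → ZMod d) : pre y 0 = [] := rfl

theorem pre_succ (y : ℕ → ZMod d) (n : ℕ) : pre y (n + 1) = y 0 :: pre (shift 1 y) n := by
  simp [pre, List.ofFn_succ, add_comm]

theorem spinePrefix_zero {y : ℕ → ZMod d} : SpinePrefix 0 y ↔ y 0 = 0 := by
  simp [SpinePrefix]

theorem spinePrefix_succ {r : ℕ} {y : ℕ → ZMod d} :
    SpinePrefix (r + 1) y ↔ y 0 = -1 ∧ SpinePrefix r (shift 1 y) := by
  constructor
  · rintro ⟨h, h'⟩
    exact ⟨h 0 (by omega), fun i hi => by simpa [add_comm] using h (i + 1) (by omega),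
      by simpa [add_comm] using h'⟩
  · rintro ⟨h0, h, h'⟩
    refine ⟨fun i hi => ?_, by simpa [add_comm] using h'⟩
    cases i with
    | zero => exact h0
    | succ i => simpa [add_comm] using h i (by omega)

theorem zero_ne_neg_one (hd : 3 ≤ d) : (0 : ZMod d) ≠ -1 := by
  have : Fact (1 < d) := ⟨by omega⟩
  exact (neg_ne_zero.2 one_ne_zero).symm

theorem one_ne_zero' (hd : 3 ≤ d) : (1 : ZMod d) ≠ 0 := by
  have : Fact (1 < d) := ⟨by omega⟩
  exact one_ne_zero

/-- Otherwise `d` divides `2`. Hence `1` differs from both letters that occur in spine prefixes, and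
a word beginning with it is off the spine. -/
theorem one_ne_neg_one (hd : 3 ≤ d) : (1 : ZMod d) ≠ -1 := by
  intro h
  have h2 : ((2 : ℕ) : ZMod d) = 0 := by
    push_cast
    linear_combination h
  rw [ZMod.natCast_eq_zero_iff] at h2
  have := Nat.le_of_dvd (by norm_num) h2
  omega

theorem onSpine_iff {y : ℕ → ZMod d} :
    OnSpine y ↔ y 0 = 0 ∨ (y 0 = -1 ∧ OnSpine (shift 1 y)) := by
  constructor
  · rintro ⟨r, hr⟩
    cases r with
    | zero => exact Or.inl (spinePrefix_zero.1 hr)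
    | succ r => exact Or.inr ⟨(spinePrefix_succ.1 hr).1, r, (spinePrefix_succ.1 hr).2⟩
  · rintro (h | ⟨h, r, hr⟩)
    · exact ⟨0, spinePrefix_zero.2 h⟩
    · exact ⟨r + 1, spinePrefix_succ.2 ⟨h, hr⟩⟩

end Words

/-! ### The generators and their action on infinite words -/

section Action

variable {d m : ℕ}

theorem smul_eq_of_pre {X : Type} {g : TreeAut X} {y z : ℕ → X}
    (h : ∀ n, g.1 (pre y n) = pre z n) : g • y = z :=
  eq_of_pre_eq fun n => (pre_boundaryMap g y n).trans (h n)

theorem rotWord_add (i j : ZMod d) (w : List (ZMod d)) :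
    rotWord (i + j) w = rotWord i (rotWord j w) := by
  cases w with
  | nil => rfl
  | cons x w => simp [rotWord, add_assoc, add_comm i j]

theorem spineWord_add (w : List (ZMod d)) :
    ∀ c e : ℕ → ZMod d, spineWord (c + e) w = spineWord c (spineWord e w) := by
  induction w with
  | nil => intro c e; rfl
  | cons x w ih =>
    intro c e
    by_cases h0 : x = 0
    · simp [spineWord, h0, rotWord_add]
    · by_cases h1 : x = -1
      · have := ih (fun n => c (n + 1)) (fun n => e (n + 1))
        subst h1
        simp only [spineWord, if_neg h0, if_true, ← this]
        rfl
      · simp [spineWord, h0, h1]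

theorem rotWord_zero (w : List (ZMod d)) : rotWord 0 w = w := by
  cases w <;> simp [rotWord]

theorem spineWord_zero (w : List (ZMod d)) : spineWord (0 : ℕ → ZMod d) w = w := by
  induction w with
  | nil => rfl
  | cons x w ih =>
    simp only [spineWord, Pi.zero_apply, rotWord_zero]
    split_ifs
    · rfl
    · exact congrArg _ ih
    · rfl

/-- The rooted automorphism that adds `j` to the first letter. -/
def rot (j : ZMod d) : TreeAut (ZMod d) :=
  ⟨⟨rotWord j, rotWord (-j), rotWord_rotWord _ _ (by simp), rotWord_rotWord _ _ (by simp)⟩,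
    length_rotWord j, rotWord_prefix j⟩

theorem rot_add (i j : ZMod d) : rot (i + j) = rot i * rot j :=
  Subtype.ext (Equiv.ext fun w => rotWord_add i j w)

theorem rot_zero : rot (0 : ZMod d) = 1 :=
  Subtype.ext (Equiv.ext fun w => rotWord_zero w)

theorem spine_add (c e : ℕ → ZMod d) : spine (c + e) = spine c * spine e :=
  Subtype.ext (Equiv.ext fun w => spineWord_add w c e)

theorem spine_zero : spine (0 : ℕ → ZMod d) = 1 :=
  Subtype.ext (Equiv.ext fun w => spineWord_zero w)

/-- `j ↦ a^j` as a homomorphism. -/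
def rotHom (d : ℕ) : Multiplicative (ZMod d) →* TreeAut (ZMod d) where
  toFun j := rot j.toAdd
  map_one' := rot_zero
  map_mul' i j := rot_add i.toAdd j.toAdd

/-- `b ↦ b_ω` as a homomorphism. -/
def spineHom (ω : HomSeq d m) : Multiplicative (Fin m → ZMod d) →* TreeAut (ZMod d) where
  toFun b := spine fun n => ω n b.toAdd
  map_one' := by
    rw [← spine_zero]
    congr 1
    funext n
    simp
  map_mul' b c := by
    rw [← spine_add]
    congr 1
    funext n
    simp

theorem mem_groupA [NeZero d] {g : TreeAut (ZMod d)} : g ∈ groupA d ↔ ∃ j : ZMod d, g = rot j := by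
  have h1 : rooted d = rotHom d (Multiplicative.ofAdd 1) := rfl
  rw [groupA, Subgroup.mem_zpowers_iff]
  constructor
  · rintro ⟨k, rfl⟩
    exact ⟨_, by rw [h1, ← map_zpow]; rfl⟩
  · rintro ⟨j, rfl⟩
    refine ⟨j.val, ?_⟩
    rw [h1, ← map_zpow, ← ofAdd_zsmul]
    change rot _ = rot j
    congr 1
    simp

theorem mem_groupB {ω : HomSeq d m} {g : TreeAut (ZMod d)} :
    g ∈ groupB ω ↔ ∃ b : Fin m → ZMod d, g = spine fun n => ω n b := by
  have h : groupB ω = (spineHom ω).range := by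
    rw [groupB]
    have : (Set.range fun b : Fin m → ZMod d => spine fun n => ω n b) =
        ((spineHom ω).range : Set (TreeAut (ZMod d))) := rfl
    rw [this, Subgroup.closure_eq]
  rw [h, MonoidHom.mem_range]
  exact ⟨fun ⟨b, hb⟩ => ⟨b.toAdd, hb.symm⟩, fun ⟨b, hb⟩ => ⟨Multiplicative.ofAdd b, hb.symm⟩⟩

theorem shift_update_succ (y : ℕ → ZMod d) (k : ℕ) (x : ZMod d) :
    shift 1 (Function.update y (k + 1) x) = Function.update (shift 1 y) k x := by
  funext i
  by_cases h : i = k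
  · subst h; simp [add_comm]
  · have : 1 + i ≠ k + 1 := by omega
    simp [h, this]

theorem shift_update_zero (y : ℕ → ZMod d) (x : ZMod d) :
    shift 1 (Function.update y 0 x) = shift 1 y := by
  funext i
  simp

theorem rot_smul (j : ZMod d) (y : ℕ → ZMod d) : rot j • y = Function.update y 0 (y 0 + j) := by
  refine smul_eq_of_pre fun n => ?_
  cases n with
  | zero => rfl
  | succ n =>
    rw [pre_succ, pre_succ, Function.update_self]
    change (y 0 + j) :: pre (shift 1 y) n = _
    rw [shift_update_zero]

theorem spine_smul (hd : 3 ≤ d) {r : ℕ} (c : ℕ → ZMod d) {y : ℕ → ZMod d}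
    (hy : SpinePrefix r y) :
    spine c • y = Function.update y (r + 1) (y (r + 1) + c r) := by
  refine smul_eq_of_pre fun n => ?_
  change spineWord c (pre y n) = _
  induction r generalizing c y n with
  | zero =>
    have h0 := spinePrefix_zero.1 hy
    cases n with
    | zero => rfl
    | succ n =>
      rw [pre_succ, pre_succ, shift_update_succ]
      cases n with
      | zero => simp [spineWord, h0, pre_zero, rotWord]
      | succ n =>
        rw [pre_succ, pre_succ]
        simp [spineWord, h0, rotWord, shift_update_zero]
  | succ r ih =>
    obtain ⟨h0, h⟩ := spinePrefix_succ.1 hy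
    cases n with
    | zero => rfl
    | succ n =>
      rw [pre_succ, pre_succ, shift_update_succ]
      have := ih (fun n => c (n + 1)) h n
      simp only [spineWord, h0, if_neg (zero_ne_neg_one hd).symm, if_true, this]
      simp [h0, add_comm 1]

theorem spine_smul_of_not_onSpine (c : ℕ → ZMod d) {y : ℕ → ZMod d}
    (hy : ¬ OnSpine y) : spine c • y = y := by
  refine smul_eq_of_pre fun n => ?_
  change spineWord c (pre y n) = _
  induction n generalizing c y with
  | zero => rfl
  | succ n ih =>
    rw [pre_succ]
    rw [onSpine_iff] at hy
    push Not at hy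
    simp only [spineWord, if_neg hy.1]
    split_ifs with h
    · rw [ih _ (hy.2 h)]
    · rfl

end Action
end Spinal

namespace Spinal

/-! ### Compatibility in terms of prefixes of shifts -/

section Compatibility

variable {d : ℕ}

/-- The infinite words `ξ` and `η` have zeros at the same positions, and their shifts have
prefixes of the form `(d-1)^r 0` at the same positions. -/
def SameSpines (ξ η : ℕ → ZMod d) : Prop :=
  ∀ n, (ξ n = 0 ↔ η n = 0) ∧ (OnSpine (shift n ξ) ↔ OnSpine (shift n η))

theorem SameSpines.symm {ξ η : ℕ → ZMod d} (h : SameSpines ξ η) : SameSpines η ξ :=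
  fun n => ⟨(h n).1.symm, (h n).2.symm⟩

theorem isBlock_congr {ξ η : ℕ → ZMod d} (h : ∀ n, ξ n = 0 ↔ η n = 0) (s l : ℕ) :
    IsBlock ξ s l ↔ IsBlock η s l := by
  simp [IsBlock, h]

theorem Compatible.symm {ξ η : ℕ → ZMod d} (h : Compatible ξ η) : Compatible η ξ :=
  ⟨fun n => (h.1 n).symm, fun s l hb r =>
    (h.2 s l ((isBlock_congr h.1 s l).2 hb) r).symm⟩

theorem exists_maximal_suffix (w : List (ZMod d)) :
    ∃ r u, w = u ++ List.replicate r (-1) ∧ ∀ x ∈ u.getLast?, x ≠ -1 := by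
  induction w using List.reverseRecOn with
  | nil => exact ⟨0, [], by simp⟩
  | append_singleton w x ih =>
    by_cases hx : x = -1
    · obtain ⟨r, u, h, hu⟩ := ih
      refine ⟨r + 1, u, ?_, hu⟩
      rw [h, hx, List.replicate_succ', List.append_assoc]
    · exact ⟨0, w ++ [x], by simpa using hx⟩

/-- Membership in terms of indices. The last clause is the maximality of the suffix; it is vacuous
when the suffix is the whole word. -/
theorem inY_pre_iff {ζ : ℕ → ZMod d} {l r : ℕ} :
    InY r (pre ζ l) ↔ (∀ i < l, ζ i ≠ 0) ∧ r ≤ l ∧ (∀ i < l, l ≤ i + r → ζ i = -1) ∧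
      ∀ i, i + 1 + r = l → ζ i ≠ -1 := by
  have hz : (∀ x ∈ pre ζ l, x ≠ 0) ↔ ∀ i < l, ζ i ≠ 0 := by
    simp only [pre, List.mem_ofFn]
    constructor
    · intro h i hi
      exact h _ ⟨⟨i, hi⟩, rfl⟩
    · rintro h x ⟨i, rfl⟩
      exact h i i.2
  rw [InY, hz]
  refine and_congr_right fun _ => ?_
  constructor
  · rintro ⟨u, hu, hlast⟩
    have hlen : l = u.length + r := by
      have := congrArg List.length hu
      simpa [pre] using this
    have hget : ∀ i (hi : i < l), ζ i = (u ++ List.replicate r (-1))[i]'(by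
        simpa [hlen] using hi) := by
      intro i hi
      simp [← hu, pre]
    refine ⟨by omega, fun i hi hir => ?_, fun i hi => ?_⟩
    · rw [hget i hi, List.getElem_append_right (by omega)]
      simp
    · rw [hget i (by omega), List.getElem_append_left (by omega)]
      apply hlast
      rw [List.getLast?_eq_getElem?]
      have : u.length - 1 = i := by omega
      rw [this]
      simp
  · rintro ⟨hr, h1, h2⟩
    refine ⟨pre ζ (l - r), ?_, ?_⟩
    · apply List.ext_getElem
      · simp [pre]; omega
      · intro i hi hi'
        have hil : i < l := by simpa [pre] using hi
        by_cases h : i < l - r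
        · rw [List.getElem_append_left (by simpa [pre] using h)]
          simp [pre]
        · rw [List.getElem_append_right (by simpa [pre] using h)]
          simp only [List.getElem_replicate]
          simpa [pre] using h1 i hil (by omega)
    · intro x hx
      rw [List.getLast?_eq_getElem?] at hx
      obtain ⟨hlt, rfl⟩ := List.getElem?_eq_some_iff.1 hx
      have hlen : (pre ζ (l - r)).length = l - r := by simp [pre]
      rw [hlen] at hlt
      have := h2 (l - r - 1) (by omega)
      simpa [pre] using this

/-- If `ξ n` is nonzero, the run `(d-1)^r` starting at `n` ends the block containing `n`. It lies
inside the maximal suffix of that block, which has the same length in `η`. -/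
theorem Compatible.onSpine {ξ η : ℕ → ZMod d} (h : Compatible ξ η) {n : ℕ}
    (hn : OnSpine (shift n ξ)) : OnSpine (shift n η) := by
  classical
  obtain ⟨r, hr, hr0⟩ := hn
  by_cases hz : ξ n = 0
  · exact ⟨0, by simp [SpinePrefix, ← h.1, hz]⟩
  -- The block of `ξ` that contains the position `n` starts at `s`.
  have hex : ∃ k, k ≤ n ∧ (n - k = 0 ∨ ξ (n - k - 1) = 0) := ⟨n, le_rfl, by simp⟩
  obtain ⟨hk, hs⟩ := Nat.find_spec hex
  have hmin : ∀ j < Nat.find hex, ξ (n - j - 1) ≠ 0 := by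
    intro j hj h0
    exact Nat.find_min hex hj ⟨by omega, Or.inr h0⟩
  set k := Nat.find hex
  set s := n - k with hs'
  have hns : n = s + k := by omega
  have hnz : ∀ i < k + r, ξ (s + i) ≠ 0 := by
    intro i hi
    rcases lt_trichotomy i k with hik | hik | hik
    · have := hmin (k - i - 1) (by omega)
      rwa [show n - (k - i - 1) - 1 = s + i by omega] at this
    · rwa [hik, ← hns]
    · intro h0
      have h1 := hr (i - k) (by omega)
      have h2 : ξ n = -1 := by simpa using hr 0 (by omega)
      rw [shift_apply, show n + (i - k) = s + i by omega, h0] at h1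
      exact hz (h2.trans h1.symm)
  have hb : IsBlock ξ s (k + r) := by
    refine ⟨hs, hnz, ?_⟩
    rw [← add_assoc, ← hns]
    exact hr0
  obtain ⟨R, u, hu, hlast⟩ := exists_maximal_suffix (pre (fun i => ξ (s + i)) (k + r))
  have hR : InY R (pre (fun i => ξ (s + i)) (k + r)) := by
    refine ⟨?_, u, hu, hlast⟩
    intro x hx
    simp only [pre, List.mem_ofFn] at hx
    obtain ⟨i, rfl⟩ := hx
    exact hnz i i.2
  have hR' := (h.2 s (k + r) hb R).1 hR
  rw [inY_pre_iff] at hR hR'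
  -- Otherwise the letter just before the maximal suffix would belong to the run of letters `-1`.
  have hrR : r ≤ R := by
    by_contra hlt
    refine hR.2.2.2 (k + r - R - 1) (by omega) ?_
    have := hr (r - R - 1) (by omega)
    rw [shift_apply] at this
    rw [← this]
    congr 1
    omega
  refine ⟨r, fun i hi => ?_, (h.1 _).1 hr0⟩
  have := hR'.2.2.1 (k + i) (by omega) (by omega)
  rwa [← add_assoc, ← hns] at this

theorem Compatible.sameSpines {ξ η : ℕ → ZMod d} (h : Compatible ξ η) : SameSpines ξ η :=
  fun n => ⟨h.1 n, h.onSpine, h.symm.onSpine⟩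

/-- The first zero at or after `s + k` is the one that ends the block, so a spine prefix starting
there must have exponent `l - k`. The case `k = l` is the zero itself. -/
theorem onSpine_shift_iff_of_isBlock (hd : 3 ≤ d) {ξ : ℕ → ZMod d} {s l k : ℕ}
    (hb : IsBlock ξ s l) (hk : k ≤ l) :
    OnSpine (shift (s + k) ξ) ↔ ∀ i < l, k ≤ i → ξ (s + i) = -1 := by
  constructor
  · rintro ⟨r, hr, hr0⟩
    have hrl : k + r = l := by
      rcases lt_trichotomy (k + r) l with h | h | h
      · refine absurd hr0 ?_
        rw [shift_apply, add_assoc]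
        exact hb.2.1 _ h
      · exact h
      · have := hr (l - k) (by omega)
        rw [shift_apply, show s + k + (l - k) = s + l by omega, hb.2.2] at this
        exact absurd this (zero_ne_neg_one hd)
    intro i hi hki
    have := hr (i - k) (by omega)
    rwa [shift_apply, show s + k + (i - k) = s + i by omega] at this
  · intro h
    refine ⟨l - k, fun i hi => ?_, ?_⟩
    · rw [shift_apply, add_assoc]
      exact h _ (by omega) (by omega)
    · rw [shift_apply, show s + k + (l - k) = s + l by omega]
      exact hb.2.2

/-- The maximal suffix begins at the first position of the block from which the shift is on the
spine. A longer suffix in `η` would put `ξ` on the spine too early. -/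
theorem SameSpines.inY (hd : 3 ≤ d) {ξ η : ℕ → ZMod d} (h : SameSpines ξ η) {s l r : ℕ}
    (hb : IsBlock ξ s l) (hr : InY r (pre (fun i => ξ (s + i)) l)) :
    InY r (pre (fun i => η (s + i)) l) := by
  have hb' : IsBlock η s l := (isBlock_congr (fun n => (h n).1) s l).1 hb
  rw [inY_pre_iff] at hr ⊢
  obtain ⟨-, hrl, h1, h2⟩ := hr
  refine ⟨hb'.2.1, hrl, fun i hi hir => ?_, fun i hi hi1 => h2 i hi ?_⟩
  · have := (onSpine_shift_iff_of_isBlock hd hb (k := l - r) (by omega)).2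
      fun i hi hi' => h1 i hi (by omega)
    exact (onSpine_shift_iff_of_isBlock hd hb' (by omega)).1 ((h _).2.1 this) i hi (by omega)
  · have h3 : ∀ j < l, i ≤ j → η (s + j) = -1 := by
      intro j hj hij
      rcases hij.eq_or_lt with rfl | hij
      · exact hi1
      · have := (onSpine_shift_iff_of_isBlock hd hb (k := l - r) (by omega)).2
          fun i hi hi' => h1 i hi (by omega)
        exact (onSpine_shift_iff_of_isBlock hd hb' (by omega)).1 ((h _).2.1 this) j hj (by omega)
    have h4 := (h _).2.2 ((onSpine_shift_iff_of_isBlock hd hb' (k := i) (by omega)).2 h3)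
    exact (onSpine_shift_iff_of_isBlock hd hb (by omega)).1 h4 i (by omega) le_rfl

theorem compatible_iff_sameSpines (hd : 3 ≤ d) {ξ η : ℕ → ZMod d} :
    Compatible ξ η ↔ SameSpines ξ η :=
  ⟨Compatible.sameSpines, fun h => ⟨fun n => (h n).1, fun s l hb _ =>
    ⟨h.inY hd hb, h.symm.inY hd ((isBlock_congr (fun n => (h n).1) s l).1 hb)⟩⟩⟩

end Compatibility
end Spinal

namespace Spinal

/-! ### The two equivalence relations underlying the Schreier graphs -/

section Tiles

variable {d : ℕ}

/-- `y` and `z` differ at most in the first letter. -/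
def RootTile (y z : ℕ → ZMod d) : Prop := shift 1 y = shift 1 z

/-- `y` and `z` have the same prefix `(d-1)^r 0` and differ at most in the letter that follows. -/
def SpineTile (y z : ℕ → ZMod d) : Prop :=
  ∃ r, SpinePrefix r y ∧ SpinePrefix r z ∧ shift (r + 2) y = shift (r + 2) z

theorem SpineTile.symm {y z : ℕ → ZMod d} (h : SpineTile y z) : SpineTile z y := by
  obtain ⟨r, h1, h2, h3⟩ := h
  exact ⟨r, h2, h1, h3.symm⟩

theorem SpineTile.onSpine {y z : ℕ → ZMod d} (h : SpineTile y z) : OnSpine y := by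
  obtain ⟨r, h1, -⟩ := h
  exact ⟨r, h1⟩

theorem onSpine_iff_spineTile {y : ℕ → ZMod d} : OnSpine y ↔ SpineTile y y :=
  ⟨fun ⟨r, h⟩ => ⟨r, h, h, rfl⟩, SpineTile.onSpine⟩

theorem SpineTile.apply_zero {y z : ℕ → ZMod d} (h : SpineTile y z) : y 0 = z 0 := by
  obtain ⟨r, h1, h2, -⟩ := h
  cases r with
  | zero => rw [h1.2, h2.2]
  | succ r => rw [h1.1 0 (by omega), h2.1 0 (by omega)]

theorem eq_of_rootTile {y z : ℕ → ZMod d} (h : RootTile y z) (h0 : y 0 = z 0) : y = z := by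
  rw [← consWord_shift_one y, ← consWord_shift_one z, h0, h]

/-- Tiles of different kinds meet in at most one vertex, since the first letter is constant on a
spine tile. -/
theorem eq_of_rootTile_of_spineTile {y z : ℕ → ZMod d} (h : RootTile y z)
    (h' : SpineTile y z) : y = z := eq_of_rootTile h h'.apply_zero

theorem rootTile_consWord (x x' : ZMod d) (τ : ℕ → ZMod d) :
    RootTile (consWord x τ) (consWord x' τ) := by
  simp [RootTile, shift_one_consWord]

theorem RootTile.eq_consWord {y z : ℕ → ZMod d} (h : RootTile y z) :
    z = consWord (z 0) (shift 1 y) := by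
  rw [h, consWord_shift_one]

theorem onSpine_consWord_zero (τ : ℕ → ZMod d) : OnSpine (consWord 0 τ) :=
  ⟨0, by simp [SpinePrefix]⟩

theorem spineTile_zero_iff (hd : 3 ≤ d) {y z : ℕ → ZMod d} (hy : y 0 = 0) (hz : z 0 = 0) :
    SpineTile y z ↔ RootTile (shift 1 y) (shift 1 z) := by
  simp only [RootTile, shift_shift]
  constructor
  · rintro ⟨r, h1, h2, h3⟩
    cases r with
    | zero => exact h3
    | succ r => exact absurd (hy.symm.trans (h1.1 0 (by omega))) (zero_ne_neg_one hd)
  · intro h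
    exact ⟨0, spinePrefix_zero.2 hy, spinePrefix_zero.2 hz, h⟩

theorem spineTile_neg_one_iff (hd : 3 ≤ d) {y z : ℕ → ZMod d} (hy : y 0 = -1) (hz : z 0 = -1) :
    SpineTile y z ↔ SpineTile (shift 1 y) (shift 1 z) := by
  constructor
  · rintro ⟨r, h1, h2, h3⟩
    cases r with
    | zero => exact absurd (h1.2.symm.trans hy) (zero_ne_neg_one hd)
    | succ r =>
      refine ⟨r, (spinePrefix_succ.1 h1).2, (spinePrefix_succ.1 h2).2, ?_⟩
      rw [shift_shift, shift_shift, show 1 + (r + 2) = r + 1 + 2 by omega, h3]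
  · rintro ⟨r, h1, h2, h3⟩
    refine ⟨r + 1, spinePrefix_succ.2 ⟨hy, h1⟩, spinePrefix_succ.2 ⟨hz, h2⟩, ?_⟩
    rw [shift_shift, shift_shift] at h3
    rw [show r + 1 + 2 = 1 + (r + 2) by omega, h3]

/-- A vertex starts with the letter `0` if and only if one of the vertices in its spine tile is the
only vertex of its root tile that lies on a spine. -/
theorem apply_zero_eq_zero_iff (hd : 3 ≤ d) {y : ℕ → ZMod d} :
    y 0 = 0 ↔ ∃ z, SpineTile y z ∧ ∀ u, RootTile z u → OnSpine u → u = z := by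
  constructor
  · intro h
    -- With second letter `1`, no word in this root tile can be on the spine through a first letter
    -- `-1`, so only the first letter `0` remains.
    refine ⟨consWord 0 (consWord 1 (shift 2 y)), ?_, fun u hu hs => ?_⟩
    · rw [spineTile_zero_iff hd h rfl, shift_one_consWord, RootTile, shift_one_consWord,
        shift_shift]
    · have hsh : shift 1 u = consWord 1 (shift 2 y) := by
        rw [← hu, shift_one_consWord]
      rcases onSpine_iff.1 hs with h0 | ⟨-, h1⟩
      · exact (eq_of_rootTile hu h0.symm).symm
      · rw [hsh, onSpine_iff] at h1
        rcases h1 with h1 | ⟨h1, -⟩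
        · exact absurd h1 (one_ne_zero' hd)
        · exact absurd h1 (one_ne_neg_one hd)
  · rintro ⟨z, hz, huniq⟩
    have h1 := huniq (consWord 0 (shift 1 z)) (by rw [RootTile, shift_one_consWord])
      (onSpine_consWord_zero _)
    rw [hz.apply_zero, ← h1]
    rfl

/-! ### Partial bijections that respect tiles, and their passage to tails -/

/-- A relation between infinite words that is functional and along which steps within the tiles
can be copied. -/
structure TileSimulation (R : (ℕ → ZMod d) → (ℕ → ZMod d) → Prop) : Prop where
  eq_of_rel : ∀ {y z z'}, R y z → R y z' → z = z'
  root : ∀ {y z y'}, R y z → RootTile y y' → ∃ z', RootTile z z' ∧ R y' z'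
  spine : ∀ {y z y'}, R y z → SpineTile y y' → ∃ z', SpineTile z z' ∧ R y' z'

/-- A partial bijection between infinite words that respects the tiles. -/
def TileBisimulation (R : (ℕ → ZMod d) → (ℕ → ZMod d) → Prop) : Prop :=
  TileSimulation R ∧ TileSimulation (flip R)

variable {R : (ℕ → ZMod d) → (ℕ → ZMod d) → Prop}

theorem TileSimulation.onSpine (h : TileSimulation R) {y z : ℕ → ZMod d} (hR : R y z)
    (hy : OnSpine y) : OnSpine z := by
  obtain ⟨z', hz, -⟩ := h.spine hR (onSpine_iff_spineTile.1 hy)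
  exact hz.onSpine

theorem TileBisimulation.flip (h : TileBisimulation R) : TileBisimulation (flip R) :=
  ⟨h.2, h.1⟩

theorem TileBisimulation.apply_zero_of (hd : 3 ≤ d) (h : TileBisimulation R) {y z : ℕ → ZMod d}
    (hR : R y z) (hy : y 0 = 0) : z 0 = 0 := by
  obtain ⟨y', hy', huniq⟩ := (apply_zero_eq_zero_iff hd).1 hy
  obtain ⟨z', hz', hR'⟩ := h.1.spine hR hy'
  refine (apply_zero_eq_zero_iff hd).2 ⟨z', hz', fun u hu hs => ?_⟩
  obtain ⟨v, hv, hRv⟩ := h.2.root hR' hu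
  have := huniq v hv (h.2.onSpine hRv hs)
  subst this
  exact h.1.eq_of_rel hRv hR'

theorem TileBisimulation.apply_zero_iff (hd : 3 ≤ d) (h : TileBisimulation R)
    {y z : ℕ → ZMod d} (hR : R y z) : y 0 = 0 ↔ z 0 = 0 :=
  ⟨h.apply_zero_of hd hR, h.flip.apply_zero_of hd hR⟩

/-- The relation induced by `R` on the words without their first letters. -/
def tailRel (R : (ℕ → ZMod d) → (ℕ → ZMod d) → Prop) (τ τ' : ℕ → ZMod d) : Prop :=
  R (consWord 0 τ) (consWord 0 τ')

/-- Each root tile contains exactly one word beginning with `0`, and `R` preserves this property, so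
a root step moves the pair to these representatives. -/
theorem TileBisimulation.exists_tailRel (hd : 3 ≤ d) (h : TileBisimulation R)
    {y z : ℕ → ZMod d} (hR : R y z) : tailRel R (shift 1 y) (shift 1 z) := by
  obtain ⟨u, hu, hRu⟩ := h.1.root hR (y' := consWord 0 (shift 1 y))
    (by rw [RootTile, shift_one_consWord])
  have h0 := h.apply_zero_of hd hRu rfl
  rw [tailRel, show consWord 0 (shift 1 z) = u by rw [← h0, ← hu.eq_consWord]]
  exact hRu

/-- A root step between tails is a spine step between words beginning with `0`. A spine step between
tails is a spine step between words beginning with `-1`; these are recognized as the words on the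
spine whose first letter is not `0`. -/
theorem TileBisimulation.tailRel_simulation (hd : 3 ≤ d) (h : TileBisimulation R) :
    TileSimulation (tailRel R) where
  eq_of_rel {y z z'} h1 h2 := by
    have := congrArg (shift 1) (h.1.eq_of_rel h1 h2)
    rwa [shift_one_consWord, shift_one_consWord] at this
  root {y z y'} hR hy := by
    obtain ⟨u, hu, hRu⟩ := h.1.spine hR (y' := consWord 0 y')
      ((spineTile_zero_iff hd rfl rfl).2 (by simpa only [shift_one_consWord] using hy))
    have h0 := h.apply_zero_of hd hRu rfl
    rw [spineTile_zero_iff hd rfl h0, shift_one_consWord] at hu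
    refine ⟨shift 1 u, hu, ?_⟩
    have hcons : consWord 0 (shift 1 u) = u := by rw [← h0, consWord_shift_one]
    rwa [tailRel, hcons]
  spine {y z y'} hR hy := by
    obtain ⟨u, hu, hRu⟩ := h.1.root hR (rootTile_consWord 0 (-1) y)
    have hs : OnSpine (consWord (-1) y) :=
      onSpine_iff.2 (Or.inr ⟨rfl, by rw [shift_one_consWord]; exact hy.onSpine⟩)
    have hu0 : u 0 ≠ 0 := fun h0 =>
      zero_ne_neg_one hd ((h.apply_zero_iff hd hRu).2 h0).symm
    have hu1 : u 0 = -1 := ((onSpine_iff.1 (h.1.onSpine hRu hs)).resolve_left hu0).1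
    obtain ⟨v, hv, hRv⟩ := h.1.spine hRu (y' := consWord (-1) y')
      ((spineTile_neg_one_iff hd rfl rfl).2 (by simpa only [shift_one_consWord] using hy))
    rw [spineTile_neg_one_iff hd hu1 (hv.apply_zero.symm.trans hu1),
      ← hu, shift_one_consWord] at hv
    refine ⟨shift 1 v, hv, ?_⟩
    simpa only [shift_one_consWord] using h.exists_tailRel hd hRv

theorem TileBisimulation.tailRel (hd : 3 ≤ d) (h : TileBisimulation R) :
    TileBisimulation (tailRel R) :=
  ⟨h.tailRel_simulation hd, h.flip.tailRel_simulation hd⟩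

/-- Position `n + 1` is position `n` of the tails, so the induction must let `R` vary and replace it
by `tailRel R`. -/
theorem TileBisimulation.sameSpines (hd : 3 ≤ d) (h : TileBisimulation R) {y z : ℕ → ZMod d}
    (hR : R y z) : SameSpines y z := by
  intro n
  induction n generalizing R y z with
  | zero =>
    simp only [shift_zero]
    exact ⟨h.apply_zero_iff hd hR, h.1.onSpine hR, h.2.onSpine hR⟩
  | succ n ih =>
    have := ih (h.tailRel hd) (h.exists_tailRel hd hR)
    simpa only [shift_apply, shift_shift, add_comm 1 n] using this

/-! ### Recovering the tiles from adjacency -/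

/-- Two distinct infinite words are adjacent if they lie in a common tile. -/
def TileAdj (y z : ℕ → ZMod d) : Prop := y ≠ z ∧ (RootTile y z ∨ SpineTile y z)

theorem SpinePrefix.spineTile_update {r : ℕ} {y : ℕ → ZMod d} (h : SpinePrefix r y)
    (x : ZMod d) :
    SpineTile y (Function.update y (r + 1) x) := by
  refine ⟨r, h, ⟨fun i hi => ?_, ?_⟩, ?_⟩
  · rw [Function.update_of_ne (by omega), h.1 i hi]
  · rw [Function.update_of_ne (by omega), h.2]
  · funext k
    rw [shift_apply, shift_apply, Function.update_of_ne (by omega)]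

/-- On the spine, two nontrivial cliques meet only in `y`; a neighbour from each gives a nonadjacent
pair. Off the spine, all neighbours lie in the root tile of `y`. -/
theorem onSpine_iff_tileAdj (hd : 3 ≤ d) {y : ℕ → ZMod d} :
    OnSpine y ↔ ∃ u v, u ≠ v ∧ TileAdj y u ∧ TileAdj y v ∧ ¬ TileAdj u v := by
  constructor
  · rintro ⟨r, hr⟩
    have h1 := one_ne_zero' hd
    set u := Function.update y 0 (y 0 + 1) with hu
    set v := Function.update y (r + 1) (y (r + 1) + 1) with hv
    have hu0 : u 0 = y 0 + 1 := by simp [hu]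
    have hv0 : v 0 = y 0 := by simp [hv]
    have hur : u (r + 1) = y (r + 1) := by simp [hu]
    have hvr : v (r + 1) = y (r + 1) + 1 := by simp [hv]
    refine ⟨u, v, fun h => ?_, ⟨fun h => ?_, Or.inl (shift_update_zero _ _).symm⟩,
      ⟨fun h => ?_, Or.inr (hr.spineTile_update _)⟩, fun h => ?_⟩
    · have := congrFun h 0
      rw [hu0, hv0] at this
      exact h1 (by simpa using this)
    · have := congrFun h 0
      rw [hu0] at this
      exact h1 (by simpa using this)
    · have := congrFun h (r + 1)
      rw [hvr] at this
      exact h1 (by simpa using this)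
    · rcases h.2 with h | h
      · have := congrFun h r
        rw [shift_apply, shift_apply, add_comm 1 r, hur, hvr] at this
        exact h1 (by simpa using this)
      · have := h.apply_zero
        rw [hu0, hv0] at this
        exact h1 (by simpa using this)
  · rintro ⟨u, v, huv, ⟨-, hu⟩, ⟨-, hv⟩, hn⟩
    by_contra hy
    have hu' := hu.resolve_right fun h => hy h.onSpine
    have hv' := hv.resolve_right fun h => hy h.onSpine
    exact hn ⟨huv, Or.inl (hu'.symm.trans hv')⟩

theorem not_onSpine_consWord_one (hd : 3 ≤ d) (τ : ℕ → ZMod d) : ¬ OnSpine (consWord 1 τ) := by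
  rw [onSpine_iff]
  rintro (h | ⟨h, -⟩)
  · exact one_ne_zero' hd h
  · exact one_ne_neg_one hd h

/-- The word with first letter `1` in a root tile is off the spine, and the closed neighbourhood of
a vertex off the spine is its root tile. -/
theorem rootTile_iff_tileAdj (hd : 3 ≤ d) {y z : ℕ → ZMod d} :
    RootTile y z ↔ ∃ u, ¬ OnSpine u ∧ (u = y ∨ TileAdj u y) ∧ (u = z ∨ TileAdj u z) := by
  constructor
  · intro h
    refine ⟨consWord 1 (shift 1 y), not_onSpine_consWord_one hd _, ?_, ?_⟩
    · rw [or_iff_not_imp_left]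
      exact fun hne => ⟨hne, Or.inl (shift_one_consWord _ _)⟩
    · rw [or_iff_not_imp_left]
      exact fun hne => ⟨hne, Or.inl ((shift_one_consWord _ _).trans h)⟩
  · rintro ⟨u, hu, h1, h2⟩
    have key : ∀ w, (u = w ∨ TileAdj u w) → RootTile u w := by
      rintro w (rfl | ⟨-, h | h⟩)
      · rfl
      · exact h
      · exact absurd h.onSpine hu
    exact (key y h1).symm.trans (key z h2)

theorem spineTile_iff_tileAdj {y z : ℕ → ZMod d} :
    SpineTile y z ↔ (y = z ∧ OnSpine y) ∨ (TileAdj y z ∧ ¬ RootTile y z) := by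
  constructor
  · intro h
    by_cases hyz : y = z
    · exact Or.inl ⟨hyz, h.onSpine⟩
    · exact Or.inr ⟨⟨hyz, Or.inr h⟩, fun h' => hyz (eq_of_rootTile_of_spineTile h' h)⟩
  · rintro (⟨rfl, h⟩ | ⟨⟨-, h⟩, h'⟩)
    · exact onSpine_iff_spineTile.1 h
    · exact h.resolve_left h'

/-- A relation that is functional and along which adjacent vertices can be copied. -/
structure AdjSimulation (R : (ℕ → ZMod d) → (ℕ → ZMod d) → Prop) : Prop where
  eq_of_rel : ∀ {y z z'}, R y z → R y z' → z = z'
  adj : ∀ {y z y'}, R y z → TileAdj y y' → ∃ z', TileAdj z z' ∧ R y' z'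

theorem AdjSimulation.tileAdj (h : AdjSimulation R) {y z y' z' : ℕ → ZMod d} (hR : R y z)
    (hR' : R y' z') (ha : TileAdj y y') : TileAdj z z' := by
  obtain ⟨w, hw, hRw⟩ := h.adj hR ha
  rwa [h.eq_of_rel hR' hRw]

/-- The reverse simulation keeps the two neighbours of the criterion distinct and nonadjacent. -/
theorem AdjSimulation.onSpine (hd : 3 ≤ d) (h : AdjSimulation R) (h' : AdjSimulation (flip R))
    {y z : ℕ → ZMod d} (hR : R y z) (hy : OnSpine y) : OnSpine z := by
  obtain ⟨u, v, huv, hu, hv, hn⟩ := (onSpine_iff_tileAdj hd).1 hy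
  obtain ⟨u', hu', hRu⟩ := h.adj hR hu
  obtain ⟨v', hv', hRv⟩ := h.adj hR hv
  refine (onSpine_iff_tileAdj hd).2 ⟨u', v', ?_, hu', hv', fun ha => hn (h'.tileAdj hRu hRv ha)⟩
  rintro rfl
  exact huv (h'.eq_of_rel hRu hRv)

theorem AdjSimulation.rootTile (hd : 3 ≤ d) (h : AdjSimulation R) (h' : AdjSimulation (flip R))
    {y z y' z' : ℕ → ZMod d} (hR : R y z) (hR' : R y' z') (ha : RootTile y y') :
    RootTile z z' := by
  obtain ⟨u, hu, h1, h2⟩ := (rootTile_iff_tileAdj hd).1 ha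
  have hex : ∃ u', R u u' := by
    rcases h1 with rfl | h1
    · exact ⟨z, hR⟩
    · obtain ⟨u', -, hu'⟩ := h.adj hR ⟨h1.1.symm, h1.2.imp Eq.symm SpineTile.symm⟩
      exact ⟨u', hu'⟩
  obtain ⟨u', hu'⟩ := hex
  refine (rootTile_iff_tileAdj hd).2 ⟨u', fun hs => hu (h'.onSpine hd h hu' hs), ?_, ?_⟩
  · rcases h1 with rfl | h1
    · exact Or.inl (h.eq_of_rel hu' hR)
    · exact Or.inr (h.tileAdj hu' hR h1)
  · rcases h2 with rfl | h2
    · exact Or.inl (h.eq_of_rel hu' hR')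
    · exact Or.inr (h.tileAdj hu' hR' h2)

theorem AdjSimulation.tileSimulation (hd : 3 ≤ d) (h : AdjSimulation R)
    (h' : AdjSimulation (flip R)) : TileSimulation R where
  eq_of_rel := h.eq_of_rel
  root {y z y'} hR hy := by
    by_cases hne : y = y'
    · subst hne
      exact ⟨z, rfl, hR⟩
    · obtain ⟨z', -, hR'⟩ := h.adj hR ⟨hne, Or.inl hy⟩
      exact ⟨z', h.rootTile hd h' hR hR' hy, hR'⟩
  spine {y z y'} hR hy := by
    by_cases hne : y = y'
    · subst hne
      exact ⟨z, onSpine_iff_spineTile.1 (h.onSpine hd h' hR hy.onSpine), hR⟩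
    · obtain ⟨z', hz', hR'⟩ := h.adj hR ⟨hne, Or.inr hy⟩
      refine ⟨z', spineTile_iff_tileAdj.2 (Or.inr ⟨hz', fun hr => hne ?_⟩), hR'⟩
      exact eq_of_rootTile_of_spineTile (h'.rootTile hd h hR hR' hr) hy

end Tiles
end Spinal

namespace Spinal

/-! ### Isomorphic Schreier graphs have compatible vertices -/

section Rigidity

variable {d m : ℕ} {ω : HomSeq d m}

theorem mem_spinalGens [NeZero d] {s : TreeAut (ZMod d)} :
    s ∈ spinalGens ω ↔
      ((∃ j : ZMod d, s = rot j) ∨ ∃ b : Fin m → ZMod d, s = spine fun n => ω n b) ∧ s ≠ 1 := by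
  rw [← mem_groupA, ← mem_groupB]
  rfl

theorem rootTile_rot_smul (j : ZMod d) (y : ℕ → ZMod d) : RootTile y (rot j • y) := by
  rw [RootTile, rot_smul, shift_update_zero]

theorem spineTile_spine_smul (hd : 3 ≤ d) (c : ℕ → ZMod d) {y : ℕ → ZMod d} (hy : OnSpine y) :
    SpineTile y (spine c • y) := by
  obtain ⟨r, hr⟩ := hy
  rw [spine_smul hd c hr]
  exact hr.spineTile_update _

theorem tileAdj_smul [NeZero d] (hd : 3 ≤ d) {s : TreeAut (ZMod d)} (hs : s ∈ spinalGens ω)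
    {y : ℕ → ZMod d} (hne : y ≠ s • y) : TileAdj y (s • y) := by
  refine ⟨hne, ?_⟩
  obtain ⟨⟨j, rfl⟩ | ⟨b, rfl⟩, -⟩ := mem_spinalGens.1 hs
  · exact Or.inl (rootTile_rot_smul j y)
  · by_cases hy : OnSpine y
    · exact Or.inr (spineTile_spine_smul hd _ hy)
    · exact absurd (spine_smul_of_not_onSpine _ hy).symm hne

/-- Surjectivity of `ω r` realizes every change of the letter after the spine prefix. -/
theorem exists_smul_eq_of_tileAdj [NeZero d] (hd : 3 ≤ d) (hω : ω ∈ Omega d m)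
    {y z : ℕ → ZMod d} (h : TileAdj y z) : ∃ s ∈ spinalGens ω, s • y = z := by
  have key : ∃ s : TreeAut (ZMod d), ((∃ j : ZMod d, s = rot j) ∨
      ∃ b : Fin m → ZMod d, s = spine fun n => ω n b) ∧ s • y = z := by
    rcases h.2 with h | ⟨r, h1, h2, h3⟩
    · refine ⟨_, Or.inl ⟨z 0 - y 0, rfl⟩, ?_⟩
      rw [rot_smul]
      refine eq_of_rootTile ?_ (by simp)
      rw [RootTile, shift_update_zero, h]
    · obtain ⟨b, hb⟩ := hω.1 r (z (r + 1) - y (r + 1))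
      refine ⟨_, Or.inr ⟨b, rfl⟩, ?_⟩
      rw [spine_smul hd _ h1, hb]
      funext k
      rcases lt_trichotomy k (r + 1) with hk | rfl | hk
      · rw [Function.update_of_ne (by omega)]
        rcases (Nat.lt_succ_iff.1 hk).lt_or_eq with hk | rfl
        · rw [h1.1 k hk, h2.1 k hk]
        · rw [h1.2, h2.2]
      · simp
      · rw [Function.update_of_ne (by omega)]
        obtain ⟨i, rfl⟩ := Nat.exists_eq_add_of_lt hk
        have := congrFun h3 i
        rw [shift_apply, shift_apply] at this
        rwa [show r + 1 + i + 1 = r + 2 + i by omega]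
  obtain ⟨s, hs, hsy⟩ := key
  refine ⟨s, mem_spinalGens.2 ⟨hs, ?_⟩, hsy⟩
  rintro rfl
  exact h.1 (by rw [← hsy, one_smul])

theorem smul_mem_orbit {ξ y : ℕ → ZMod d} {s : TreeAut (ZMod d)} (hs : s ∈ spinalGens ω)
    (hy : y ∈ MulAction.orbit (spinalGroup ω) ξ) :
    s • y ∈ MulAction.orbit (spinalGroup ω) ξ :=
  MulAction.mem_orbit_of_mem_orbit (⟨s, spinalGens_subset ω hs⟩ : spinalGroup ω) hy

theorem tileAdj_of_isLink [NeZero d] (hd : 3 ≤ d) {ξ u v : ℕ → ZMod d}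
    {e : TreeAut (ZMod d) × (ℕ → ZMod d)} (h : (boundaryGraph ω ξ).IsLink e u v)
    (hne : u ≠ v) : TileAdj u v := by
  obtain ⟨hs, -, ⟨rfl, rfl⟩ | ⟨rfl, rfl⟩⟩ := h
  · exact tileAdj_smul hd hs hne
  · have := tileAdj_smul hd hs hne.symm
    exact ⟨hne, this.2.imp Eq.symm SpineTile.symm⟩

/-- The graph of an isomorphism between Schreier graphs copies adjacent vertices. -/
theorem adjSimulation_of_isLink [NeZero d] (hd : 3 ≤ d) (hω : ω ∈ Omega d m) {η ξ : ℕ → ZMod d}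
    (f : (boundaryGraph ω η).vertexSet ≃ (boundaryGraph ω ξ).vertexSet)
    (k : (boundaryGraph ω η).edgeSet ≃ (boundaryGraph ω ξ).edgeSet)
    (h : ∀ (e : (boundaryGraph ω η).edgeSet) (u v : (boundaryGraph ω η).vertexSet),
      (boundaryGraph ω η).IsLink e u v ↔ (boundaryGraph ω ξ).IsLink (k e) (f u) (f v)) :
    AdjSimulation fun y z => 
      ∃ hy : y ∈ (boundaryGraph ω η).vertexSet, (f ⟨y, hy⟩ : ℕ → ZMod d) = z where
  eq_of_rel := by
    rintro y z z' ⟨hy, rfl⟩ ⟨hy', rfl⟩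
    rfl
  adj := by
    rintro y z y' ⟨hy, rfl⟩ ha
    obtain ⟨s, hs, rfl⟩ := exists_smul_eq_of_tileAdj hd hω ha
    have hy' : s • y ∈ (boundaryGraph ω η).vertexSet := smul_mem_orbit hs hy
    have hl : (boundaryGraph ω η).IsLink (s, y) y (s • y) := ⟨hs, hy, Or.inl ⟨rfl, rfl⟩⟩
    refine ⟨f ⟨s • y, hy'⟩, ?_, hy', rfl⟩
    refine tileAdj_of_isLink hd ((h ⟨(s, y), hl.edge_mem⟩ ⟨y, hy⟩ ⟨s • y, hy'⟩).1 hl) ?_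
    intro heq
    have := f.injective (Subtype.ext heq)
    exact ha.1 (congrArg Subtype.val this)

theorem exists_compatible_of_graphIsomorphic [NeZero d] (hd : 3 ≤ d) (hω : ω ∈ Omega d m)
    {η ξ : ℕ → ZMod d} (h : GraphIsomorphic (boundaryGraph ω η) (boundaryGraph ω ξ)) :
    ∃ g ∈ spinalGroup ω, Compatible (g • ξ) η := by
  obtain ⟨f, k, hfk⟩ := h
  have h1 := adjSimulation_of_isLink hd hω f k hfk
  have h2 := adjSimulation_of_isLink hd hω f.symm k.symm fun e u v => by
    rw [hfk]; simp
  set R : (ℕ → ZMod d) → (ℕ → ZMod d) → Prop := fun y z =>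
    ∃ hy : y ∈ (boundaryGraph ω η).vertexSet, (f ⟨y, hy⟩ : ℕ → ZMod d) = z with hR
  have hflip : (fun y z => ∃ hy : y ∈ (boundaryGraph ω ξ).vertexSet,
      (f.symm ⟨y, hy⟩ : ℕ → ZMod d) = z) = flip R := by
    funext z y
    refine propext ⟨?_, ?_⟩
    · rintro ⟨hz, rfl⟩
      exact ⟨(f.symm ⟨z, hz⟩).2, by simp⟩
    · rintro ⟨hy, rfl⟩
      exact ⟨(f ⟨y, hy⟩).2, by simp⟩
  rw [hflip] at h2
  have hbis : TileBisimulation R := ⟨h1.tileSimulation hd h2, h2.tileSimulation hd h1⟩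
  have hη : η ∈ (boundaryGraph ω η).vertexSet := MulAction.mem_orbit_self η
  have hs := hbis.sameSpines hd (y := η) (z := f ⟨η, hη⟩) ⟨hη, rfl⟩
  -- The image of the vertex `η` lies in the orbit of `ξ`, which provides the group element.
  obtain ⟨g, hg⟩ := (f ⟨η, hη⟩).2
  refine ⟨g, g.2, ((compatible_iff_sameSpines hd).2 ?_)⟩
  have hg' : (g : TreeAut (ZMod d)) • ξ = f ⟨η, hη⟩ := hg
  rw [hg']
  exact hs.symm

end Rigidity
end Spinal

namespace Spinal

/-! ### Compatible vertices have isomorphic Schreier graphs -/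

section Transport

variable {d m : ℕ} {ω : HomSeq d m}

open Classical in
/-- The permutation of the letters of index `n` by which the isomorphism that maps `η` to `ζ` acts
on the word `y`. -/
noncomputable def letterPerm (η ζ y : ℕ → ZMod d) (n : ℕ) : Equiv.Perm (ZMod d) :=
  if ∀ k > n, y k = η k then Equiv.swap (η n) (ζ n) else 1

/-- The map of vertices that maps `η` to `ζ` and preserves the tiles if `η` and `ζ` are
compatible. -/
noncomputable def transport (η ζ y : ℕ → ZMod d) : ℕ → ZMod d := fun n => letterPerm η ζ y n (y n)

/-- The infinite words `y` and `z` differ in finitely many letters only. -/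
def Cofinal (y z : ℕ → ZMod d) : Prop := ∃ N, ∀ k ≥ N, y k = z k

variable {η ζ : ℕ → ZMod d}

theorem transport_self : transport η ζ η = ζ := by
  funext n
  simp [transport, letterPerm]

theorem letterPerm_congr {y z : ℕ → ZMod d} {n : ℕ} (h : ∀ k > n, y k = z k) :
    letterPerm η ζ y n = letterPerm η ζ z n := by
  have : (∀ k > n, y k = η k) ↔ ∀ k > n, z k = η k :=
    forall₂_congr fun k hk => by rw [h k hk]
  by_cases hz : ∀ k > n, z k = η k
  · rw [letterPerm, letterPerm, if_pos hz, if_pos (this.2 hz)]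
  · rw [letterPerm, letterPerm, if_neg hz, if_neg (mt this.1 hz)]

theorem transport_congr {y z : ℕ → ZMod d} {n : ℕ} (h : ∀ k ≥ n, y k = z k) {k : ℕ}
    (hk : n ≤ k) : transport η ζ y k = transport η ζ z k := by
  rw [transport, transport, h k hk, letterPerm_congr fun i hi => h i (by omega)]

/-- The condition that selects the swap can be read off from the image, which makes `transport`
invertible by exchanging `η` and `ζ`. -/
theorem transport_agree_iff {y : ℕ → ZMod d} (hy : Cofinal y η) {n : ℕ} :
    (∀ k > n, transport η ζ y k = ζ k) ↔ ∀ k > n, y k = η k := by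
  constructor
  · intro h
    obtain ⟨N, hN⟩ := hy
    -- Downward induction from `N`: agreement beyond `k` makes the permutation at `k` the swap,
    -- whose injectivity gives agreement at `k`.
    have key : ∀ j, ∀ k > n, N ≤ k + j → y k = η k := by
      intro j
      induction j with
      | zero => exact fun k _ hk => hN k hk
      | succ j ih =>
        intro k hk hkj
        have h1 : ∀ i > k, y i = η i := fun i hi => ih i (by omega) (by omega)
        have h2 := h k hk
        rw [transport, letterPerm, if_pos h1] at h2
        exact (Equiv.swap (η k) (ζ k)).injective (h2.trans (Equiv.swap_apply_left _ _).symm)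
    exact fun k hk => key N k hk (by omega)
  · intro h k hk
    rw [transport_congr (z := η) (n := k) (fun i hi => h i (by omega)) le_rfl, transport_self]

theorem transport_transport {y : ℕ → ZMod d} (hy : Cofinal y η) :
    transport ζ η (transport η ζ y) = y := by
  funext n
  by_cases h : ∀ k > n, y k = η k
  · have h' := (transport_agree_iff (ζ := ζ) hy).2 h
    rw [transport, letterPerm, if_pos h', transport, letterPerm, if_pos h, Equiv.swap_comm,
      Equiv.swap_apply_self]
  · have h' := mt (transport_agree_iff (ζ := ζ) hy).1 h
    rw [transport, letterPerm, if_neg h', transport, letterPerm, if_neg h]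
    rfl

theorem Cofinal.transport {y : ℕ → ZMod d} (hy : Cofinal y η) : Cofinal (transport η ζ y) ζ := by
  obtain ⟨N, hN⟩ := hy
  exact ⟨N, fun k hk => by rw [transport_congr hN hk, transport_self]⟩

theorem SameSpines.letterPerm_zero (h : SameSpines η ζ) (y : ℕ → ZMod d) (n : ℕ) :
    letterPerm η ζ y n 0 = 0 := by
  rw [letterPerm]
  split_ifs
  · by_cases h0 : η n = 0
    · rw [h0, (h n).1.1 h0, Equiv.swap_self]
      rfl
    · exact Equiv.swap_apply_of_ne_of_ne (Ne.symm h0) (Ne.symm (mt (h n).1.2 h0))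
  · rfl

theorem SameSpines.neg_one_of (hd : 3 ≤ d) (h : SameSpines η ζ) {n : ℕ}
    (hs : OnSpine (shift (n + 1) η)) (hn : η n = -1) : ζ n = -1 := by
  have h1 : OnSpine (shift n η) := onSpine_iff.2 (Or.inr ⟨hn, by rwa [shift_shift]⟩)
  rcases onSpine_iff.1 ((h n).2.1 h1) with h2 | h2
  · exact absurd (((h n).1.2 h2).symm.trans hn) (zero_ne_neg_one hd)
  · exact h2.1

/-- If the tail is on the spine and agrees with that of `η`, then `η n = -1` and `ζ n = -1` are
equivalent, so the swap does not move `-1`. -/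
theorem SameSpines.letterPerm_neg_one (hd : 3 ≤ d) (h : SameSpines η ζ) {y : ℕ → ZMod d} {n : ℕ}
    (hs : OnSpine (shift (n + 1) y)) : letterPerm η ζ y n (-1) = -1 := by
  rw [letterPerm]
  split_ifs with hy
  · have hs' : OnSpine (shift (n + 1) η) := by
      have : shift (n + 1) y = shift (n + 1) η := funext fun k => hy _ (by omega)
      rwa [← this]
    by_cases h0 : η n = -1
    · rw [h0, h.neg_one_of hd hs' h0, Equiv.swap_self]
      rfl
    · refine Equiv.swap_apply_of_ne_of_ne (Ne.symm h0) fun h1 => h0 ?_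
      exact h.symm.neg_one_of hd ((h _).2.1 hs') h1.symm
  · rfl

theorem SpinePrefix.onSpine_shift {r i : ℕ} {y : ℕ → ZMod d} (hy : SpinePrefix r y)
    (hi : i ≤ r) : OnSpine (shift i y) := by
  refine ⟨r - i, fun j hj => hy.1 _ (by omega), ?_⟩
  rw [shift_apply, show i + (r - i) = r by omega]
  exact hy.2

theorem SpinePrefix.transport (hd : 3 ≤ d) (h : SameSpines η ζ) {r : ℕ} {y : ℕ → ZMod d}
    (hy : SpinePrefix r y) : SpinePrefix r (transport η ζ y) := by
  refine ⟨fun i hi => ?_, ?_⟩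
  · rw [Spinal.transport, hy.1 i hi]
    exact h.letterPerm_neg_one hd (hy.onSpine_shift (by omega))
  · rw [Spinal.transport, hy.2]
    exact h.letterPerm_zero _ _

theorem transport_update_zero (y : ℕ → ZMod d) (x : ZMod d) :
    transport η ζ (Function.update y 0 x) =
      Function.update (transport η ζ y) 0 (letterPerm η ζ y 0 x) := by
  funext k
  rcases Nat.eq_zero_or_pos k with rfl | hk
  · rw [Function.update_self, transport, Function.update_self, letterPerm_congr (z := y)]
    exact fun i hi => by rw [Function.update_of_ne (by omega)]
  · rw [Function.update_of_ne (by omega)]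
    exact transport_congr (n := 1) (fun i hi => by rw [Function.update_of_ne (by omega)]) hk

/-- Changing letter `r + 1` may change which permutations act at smaller positions, but the letters
of the spine prefix are fixed either way. -/
theorem transport_update_of_spinePrefix (hd : 3 ≤ d) (h : SameSpines η ζ) {r : ℕ}
    {y : ℕ → ZMod d} (hy : SpinePrefix r y) (x : ZMod d) :
    transport η ζ (Function.update y (r + 1) x) =
      Function.update (transport η ζ y) (r + 1) (letterPerm η ζ y (r + 1) x) := by
  have hu : SpinePrefix r (Function.update y (r + 1) x) := by
    refine ⟨fun i hi => ?_, ?_⟩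
    · rw [Function.update_of_ne (by omega), hy.1 i hi]
    · rw [Function.update_of_ne (by omega), hy.2]
  have hy' := hy.transport hd h
  have hu' := hu.transport hd h
  funext k
  rcases lt_trichotomy k (r + 1) with hk | rfl | hk
  · rw [Function.update_of_ne (by omega)]
    rcases (Nat.lt_succ_iff.1 hk).lt_or_eq with hk | rfl
    · rw [hu'.1 k hk, hy'.1 k hk]
    · rw [hu'.2, hy'.2]
  · rw [Function.update_self, transport, Function.update_self, letterPerm_congr (z := y)]
    exact fun i hi => by rw [Function.update_of_ne (by omega)]
  · rw [Function.update_of_ne (by omega)]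
    exact transport_congr (n := r + 2) (fun i hi => by rw [Function.update_of_ne (by omega)]) hk

/-! ### The generators at corresponding vertices -/

/-- The generators are parametrized by the nontrivial elements of `A` and of `B`. -/
abbrev GenIndex (d m : ℕ) : Type := {j : ZMod d // j ≠ 0} ⊕ {b : Fin m → ZMod d // b ≠ 0}

/-- The automorphism that belongs to the parameter. -/
def genOfIndex (ω : HomSeq d m) : GenIndex d m → TreeAut (ZMod d) :=
  Sum.elim (fun j => rot j.1) fun b => spine fun n => ω n b.1

theorem rot_injective : Function.Injective (rot : ZMod d → TreeAut (ZMod d)) := by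
  intro i j h
  have := congrArg (fun g : TreeAut (ZMod d) => (g • (0 : ℕ → ZMod d)) 0) h
  simpa [rot_smul] using this

theorem spine_injective (hd : 3 ≤ d) :
    Function.Injective (spine : (ℕ → ZMod d) → TreeAut (ZMod d)) := by
  intro c e h
  funext r
  have hy : SpinePrefix r (fun k => if k < r then (-1 : ZMod d) else 0) :=
    ⟨fun i hi => by simp [hi], by simp⟩
  have := congrArg (fun g : TreeAut (ZMod d) =>
    (g • (fun k => if k < r then (-1 : ZMod d) else 0)) (r + 1)) h
  simpa [spine_smul hd _ hy] using this

theorem homSeq_injective (hω : ω ∈ Omega d m) :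
    Function.Injective fun (b : Fin m → ZMod d) n => ω n b := by
  intro b c h
  have h0 : b - c ∈ (⨅ j ≥ 0, (ω j).ker) := by
    simp only [AddSubgroup.mem_iInf, AddMonoidHom.mem_ker]
    intro j _
    rw [map_sub, sub_eq_zero]
    exact congrFun h j
  rw [hω.2 0, AddSubgroup.mem_bot] at h0
  exact sub_eq_zero.1 h0

theorem rot_ne_spine (hd : 3 ≤ d) {j : ZMod d} (hj : j ≠ 0) (c : ℕ → ZMod d) :
    rot j ≠ spine c := by
  intro h
  have hy : SpinePrefix 0 (0 : ℕ → ZMod d) := ⟨fun i hi => by omega, rfl⟩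
  have := congrArg (fun g : TreeAut (ZMod d) => (g • (0 : ℕ → ZMod d)) 0) h
  simp only [rot_smul, spine_smul hd c hy] at this
  exact hj (by simpa using this)

theorem genOfIndex_mem [NeZero d] (hd : 3 ≤ d) (hω : ω ∈ Omega d m) (t : GenIndex d m) :
    genOfIndex ω t ∈ spinalGens ω := by
  rw [mem_spinalGens]
  rcases t with ⟨j, hj⟩ | ⟨b, hb⟩
  · exact ⟨Or.inl ⟨j, rfl⟩, fun h => hj (rot_injective (h.trans rot_zero.symm))⟩
  · refine ⟨Or.inr ⟨b, rfl⟩, fun h => hb (homSeq_injective hω ?_)⟩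
    have := spine_injective hd (h.trans spine_zero.symm)
    funext n
    exact (congrFun this n).trans (map_zero (ω n)).symm

theorem genOfIndex_injective (hd : 3 ≤ d) (hω : ω ∈ Omega d m) :
    Function.Injective (genOfIndex ω) := by
  rintro (⟨j, hj⟩ | ⟨b, hb⟩) (⟨i, hi⟩ | ⟨c, hc⟩) h
  · have := rot_injective h
    subst this
    rfl
  · exact absurd h (rot_ne_spine hd hj _)
  · exact absurd h.symm (rot_ne_spine hd hi _)
  · have := homSeq_injective hω (spine_injective hd h)
    subst this
    rfl

/-- The parametrization of the generators as a bijection. -/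
noncomputable def genEquiv [NeZero d] (hd : 3 ≤ d) (hω : ω ∈ Omega d m) :
    GenIndex d m ≃ spinalGens ω :=
  Equiv.ofBijective (fun t => ⟨genOfIndex ω t, genOfIndex_mem hd hω t⟩) <| by
    refine ⟨fun s t h => genOfIndex_injective hd hω (congrArg Subtype.val h), ?_⟩
    rintro ⟨s, hs⟩
    obtain ⟨⟨j, rfl⟩ | ⟨b, rfl⟩, h1⟩ := mem_spinalGens.1 hs
    · refine ⟨Sum.inl ⟨j, ?_⟩, rfl⟩
      rintro rfl
      exact h1 rot_zero
    · refine ⟨Sum.inr ⟨b, ?_⟩, rfl⟩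
      rintro rfl
      refine h1 ?_
      rw [← spine_zero]
      congr 1
      funext n
      simp

/-- A permutation of the image of a surjective homomorphism that fixes `0` lifts to a permutation
that fixes `0`. -/
theorem exists_perm_lift {B C : Type*} [AddCommGroup B] [AddCommGroup C] (φ : B →+ C)
    (hφ : Function.Surjective φ) (p : Equiv.Perm C) (hp : p 0 = 0) :
    ∃ q : Equiv.Perm B, q 0 = 0 ∧ ∀ b, φ (q b) = p (φ b) := by
  choose s hs using hφ
  -- For a section `s` of `φ`, each fibre is translated onto the fibre prescribed by `p`. The fibre
  -- over `0` is translated by zero.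
  refine ⟨⟨fun b => b + (s (p (φ b)) - s (φ b)), fun b => b + (s (p.symm (φ b)) - s (φ b)),
    fun b => ?_, fun b => ?_⟩, ?_, fun b => ?_⟩
  · simp only [map_add, map_sub, hs, add_sub_cancel, Equiv.symm_apply_apply]
    abel
  · simp only [map_add, map_sub, hs, add_sub_cancel, Equiv.apply_symm_apply]
    abel
  · simp [hp]
  · simp [hs]

/-- The permutation of the differences of letters that belongs to a permutation of letters. -/
def diffPerm (p : Equiv.Perm (ZMod d)) (x : ZMod d) : Equiv.Perm (ZMod d) :=
  ((Equiv.addLeft x).trans p).trans (Equiv.subRight (p x))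

theorem diffPerm_apply (p : Equiv.Perm (ZMod d)) (x j : ZMod d) :
    diffPerm p x j = p (x + j) - p x := rfl

theorem diffPerm_zero (p : Equiv.Perm (ZMod d)) (x : ZMod d) : diffPerm p x 0 = 0 := by
  simp [diffPerm_apply]

/-- The restriction of a permutation that fixes `0` to the nonzero elements. -/
def nonzeroPerm {B : Type*} [Zero B] (q : Equiv.Perm B) (hq : q 0 = 0) :
    Equiv.Perm {b : B // b ≠ 0} :=
  q.subtypeEquiv fun b => by
    rw [not_iff_not]
    exact ⟨fun h => by rw [h, hq], fun h => q.injective (h.trans hq.symm)⟩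

theorem exists_spine_perm (hd : 3 ≤ d) (hω : ω ∈ Omega d m) (h : SameSpines η ζ)
    (h' : ∀ y, Cofinal y η → (OnSpine (transport η ζ y) → OnSpine y))
    {y : ℕ → ZMod d} (hy : Cofinal y η) :
    ∃ q : Equiv.Perm (Fin m → ZMod d), q 0 = 0 ∧ ∀ b,
      transport η ζ ((spine fun n => ω n b) • y) =
        (spine fun n => ω n (q b)) • transport η ζ y := by
  by_cases hs : OnSpine y
  · obtain ⟨r, hr⟩ := hs
    -- A letter permutation `p` turns adding `j` to `x` into adding `p (x + j) - p x` to `p x`. This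
    -- permutation of increments is lifted to `B`.
    obtain ⟨q, hq0, hq⟩ := exists_perm_lift (ω r) (hω.1 r)
      (diffPerm (letterPerm η ζ y (r + 1)) (y (r + 1))) (diffPerm_zero _ _)
    refine ⟨q, hq0, fun b => ?_⟩
    rw [spine_smul hd _ hr, spine_smul hd _ (hr.transport hd h), hq,
      transport_update_of_spinePrefix hd h hr, diffPerm_apply, transport, add_sub_cancel]
  -- Off the spine all of `B_ω` fixes both the vertex and its image, so any permutation fixing `0`
  -- would match the loops.
  · refine ⟨1, rfl, fun b => ?_⟩
    rw [spine_smul_of_not_onSpine _ hs, spine_smul_of_not_onSpine _ (mt (h' y hy) hs)]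

/-- The relabelling `κ` depends on the vertex `y`, which is harmless for unlabeled graphs. Being a
bijection, it preserves the multiplicities of loops and edges. -/
theorem exists_gens_perm [NeZero d] (hd : 3 ≤ d) (hω : ω ∈ Omega d m) (h : SameSpines η ζ)
    {y : ℕ → ZMod d} (hy : Cofinal y η) :
    ∃ κ : Equiv.Perm (spinalGens ω), ∀ s : spinalGens ω,
      transport η ζ (s.1 • y) = (κ s).1 • transport η ζ y := by
  have h' : ∀ y, Cofinal y η → (OnSpine (transport η ζ y) → OnSpine y) := by
    rintro y hy ⟨r, hr⟩
    have := hr.transport hd h.symm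
    rw [transport_transport hy] at this
    exact ⟨r, this⟩
  obtain ⟨q, hq0, hq⟩ := exists_spine_perm hd hω h h' hy
  set p := diffPerm (letterPerm η ζ y 0) (y 0) with hp
  refine ⟨(genEquiv hd hω).permCongr
    (Equiv.sumCongr (nonzeroPerm p (diffPerm_zero _ _)) (nonzeroPerm q hq0)), fun s => ?_⟩
  obtain ⟨t, rfl⟩ := (genEquiv hd hω).surjective s
  rw [Equiv.permCongr_apply, Equiv.symm_apply_apply]
  rcases t with ⟨j, hj⟩ | ⟨b, hb⟩
  · change transport η ζ (rot j • y) = rot (p j) • transport η ζ y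
    rw [rot_smul, rot_smul, transport_update_zero, hp, diffPerm_apply, transport, add_sub_cancel]
  · exact hq b

/-! ### The isomorphism -/

/-- A property of words that is invariant under the generators is invariant under the group. -/
theorem orbit_induction [NeZero d] {p : (ℕ → ZMod d) → Prop} {ξ y : ℕ → ZMod d}
    (hy : y ∈ MulAction.orbit (spinalGroup ω) ξ) (hξ : p ξ)
    (hp : ∀ s ∈ spinalGens ω, ∀ z, p z → p (s • z)) : p y := by
  have hinv : ∀ s ∈ spinalGens ω, s⁻¹ ∈ spinalGens ω := by
    rintro s ⟨hs | hs, h1⟩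
    · exact ⟨Or.inl (inv_mem hs), by simpa using h1⟩
    · exact ⟨Or.inr (inv_mem hs), by simpa using h1⟩
  obtain ⟨⟨g, hg⟩, rfl⟩ := hy
  change p (g • ξ)
  -- An equivalence for every word, available because the generating set is closed under inverses,
  -- passes to products and inverses.
  have key : ∀ z, p z ↔ p (g • z) := by
    rw [spinalGroup, Subgroup.sup_eq_closure] at hg
    induction hg using Subgroup.closure_induction with
    | mem s hs =>
      by_cases h1 : s = 1
      · simp [h1]
      · have hs' : s ∈ spinalGens ω := ⟨hs, h1⟩
        refine fun z => ⟨hp s hs' z, fun h => ?_⟩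
        simpa using hp _ (hinv s hs') _ h
    | one => simp
    | mul a b _ _ ha hb =>
      intro z
      rw [mul_smul, ← ha, ← hb]
    | inv a _ ha =>
      intro z
      rw [ha (a⁻¹ • z), smul_inv_smul]
  exact (key ξ).1 hξ

theorem cofinal_of_mem_orbit [NeZero d] (hd : 3 ≤ d) {ξ y : ℕ → ZMod d}
    (hy : y ∈ MulAction.orbit (spinalGroup ω) ξ) : Cofinal y ξ := by
  refine orbit_induction (p := fun z => Cofinal z ξ) hy ⟨0, fun _ _ => rfl⟩ ?_
  rintro s hs z ⟨N, hN⟩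
  obtain ⟨⟨j, rfl⟩ | ⟨b, rfl⟩, -⟩ := mem_spinalGens.1 hs
  · refine ⟨N + 1, fun k hk => ?_⟩
    rw [rot_smul, Function.update_of_ne (by omega), hN k (by omega)]
  · by_cases hz : OnSpine z
    · obtain ⟨r, hr⟩ := hz
      refine ⟨N + r + 2, fun k hk => ?_⟩
      rw [spine_smul hd _ hr, Function.update_of_ne (by omega), hN k (by omega)]
    · exact ⟨N, fun k hk => by rw [spine_smul_of_not_onSpine _ hz, hN k hk]⟩

theorem transport_mem_orbit [NeZero d] (hd : 3 ≤ d) (hω : ω ∈ Omega d m) (h : SameSpines η ζ)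
    {y : ℕ → ZMod d} (hy : y ∈ MulAction.orbit (spinalGroup ω) η) :
    transport η ζ y ∈ MulAction.orbit (spinalGroup ω) ζ := by
  have key : y ∈ MulAction.orbit (spinalGroup ω) η ∧
      transport η ζ y ∈ MulAction.orbit (spinalGroup ω) ζ := by
    refine orbit_induction (p := fun z => z ∈ MulAction.orbit (spinalGroup ω) η ∧
      transport η ζ z ∈ MulAction.orbit (spinalGroup ω) ζ) hy ⟨MulAction.mem_orbit_self η, ?_⟩ ?_
    · rw [transport_self]
      exact MulAction.mem_orbit_self ζ
    · rintro s hs z ⟨hz, hz'⟩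
      refine ⟨smul_mem_orbit hs hz, ?_⟩
      obtain ⟨κ, hκ⟩ := exists_gens_perm hd hω h (cofinal_of_mem_orbit hd hz)
      rw [hκ ⟨s, hs⟩]
      exact smul_mem_orbit (κ ⟨s, hs⟩).2 hz'
  exact key.2

/-- The bijection between the vertices that maps `η` to `ζ`. -/
noncomputable def vertexEquiv [NeZero d] (hd : 3 ≤ d) (hω : ω ∈ Omega d m) (h : SameSpines η ζ) :
    MulAction.orbit (spinalGroup ω) η ≃ MulAction.orbit (spinalGroup ω) ζ where
  toFun y := ⟨transport η ζ y, transport_mem_orbit hd hω h y.2⟩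
  invFun y := ⟨transport ζ η y, transport_mem_orbit hd hω h.symm y.2⟩
  left_inv y := Subtype.ext (transport_transport (cofinal_of_mem_orbit hd y.2))
  right_inv y := Subtype.ext (transport_transport (cofinal_of_mem_orbit hd y.2))

/-- The edges of a Schreier graph are the pairs of a generator and a vertex. -/
def edgeEquiv (ω : HomSeq d m) (ξ : ℕ → ZMod d) :
    MulAction.orbit (spinalGroup ω) ξ × spinalGens ω ≃ (boundaryGraph ω ξ).edgeSet where
  toFun e := ⟨(e.2, e.1), e.1, e.2.1 • e.1.1, e.2.2, e.1.2, Or.inl ⟨rfl, rfl⟩⟩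
  invFun e := (⟨e.1.2, by obtain ⟨_, _, -, h, -⟩ := e.2; exact h⟩,
    ⟨e.1.1, by obtain ⟨_, _, h, -⟩ := e.2; exact h⟩)
  left_inv _ := rfl
  right_inv _ := rfl

theorem graphIsomorphic_of_sameSpines [NeZero d] (hd : 3 ≤ d) (hω : ω ∈ Omega d m)
    (h : SameSpines η ζ) : GraphIsomorphic (boundaryGraph ω η) (boundaryGraph ω ζ) := by
  choose κ hκ using fun y : MulAction.orbit (spinalGroup ω) η =>
    exists_gens_perm hd hω h (cofinal_of_mem_orbit hd y.2)
  refine ⟨vertexEquiv hd hω h,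
    ((edgeEquiv ω η).symm.trans (Equiv.prodShear (vertexEquiv hd hω h) κ)).trans
      (edgeEquiv ω ζ), fun e (u v : MulAction.orbit (spinalGroup ω) η) => ?_⟩
  obtain ⟨⟨y, s⟩, rfl⟩ := (edgeEquiv ω η).surjective e
  rw [Equiv.trans_apply, Equiv.trans_apply, Equiv.symm_apply_apply]
  have hsy : s.1 • y.1 ∈ MulAction.orbit (spinalGroup ω) η := smul_mem_orbit s.2 y.2
  have h1 : (boundaryGraph ω η).IsLink (edgeEquiv ω η (y, s)) u v ↔
      ((u = y ∧ v = ⟨s.1 • y.1, hsy⟩) ∨ (v = y ∧ u = ⟨s.1 • y.1, hsy⟩)) := by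
    simp only [Subtype.ext_iff]
    exact ⟨fun h => h.2.2, fun h => ⟨s.2, y.2, h⟩⟩
  have h2 : (boundaryGraph ω ζ).IsLink
      (edgeEquiv ω ζ (Equiv.prodShear (vertexEquiv hd hω h) κ (y, s)))
      (vertexEquiv hd hω h u) (vertexEquiv hd hω h v) ↔
      ((vertexEquiv hd hω h u = vertexEquiv hd hω h y ∧
        vertexEquiv hd hω h v = vertexEquiv hd hω h ⟨s.1 • y.1, hsy⟩) ∨
      (vertexEquiv hd hω h v = vertexEquiv hd hω h y ∧
        vertexEquiv hd hω h u = vertexEquiv hd hω h ⟨s.1 • y.1, hsy⟩)) := by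
    have h3 : (vertexEquiv hd hω h ⟨s.1 • y.1, hsy⟩ : ℕ → ZMod d) =
      (κ y s).1 • (vertexEquiv hd hω h y : ℕ → ZMod d) := hκ y s
    simp only [Subtype.ext_iff, h3]
    exact ⟨fun h => h.2.2, fun h' => ⟨(κ y s).2, (vertexEquiv hd hω h y).2, h'⟩⟩
  refine (h1.trans ?_).trans h2.symm
  simp only [EmbeddingLike.apply_eq_iff_eq]

theorem boundaryGraph_smul {g : TreeAut (ZMod d)} (hg : g ∈ spinalGroup ω) (ξ : ℕ → ZMod d) :
    boundaryGraph ω (g • ξ) = boundaryGraph ω ξ := by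
  have : MulAction.orbit (spinalGroup ω) (g • ξ) = MulAction.orbit (spinalGroup ω) ξ :=
    MulAction.orbit_eq_iff.2 (MulAction.mem_orbit ξ (⟨g, hg⟩ : spinalGroup ω))
  simp only [boundaryGraph, schreierGraph, this]

theorem isoClass_eq [NeZero d] (hd : 3 ≤ d) (hω : ω ∈ Omega d m) (ξ : ℕ → ZMod d) :
    isoClass ω ξ = ⋃ g ∈ spinalGroup ω, compClass (g • ξ) := by
  ext η
  simp only [Set.mem_iUnion, exists_prop]
  constructor
  · exact exists_compatible_of_graphIsomorphic hd hω
  · rintro ⟨g, hg, h⟩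
    have := graphIsomorphic_of_sameSpines hd hω h.symm.sameSpines
    rwa [boundaryGraph_smul hg] at this

end Transport
end Spinal

namespace Spinal

/-! ### The measure -/

section Measure

variable {d m : ℕ}

theorem length_pre {X : Type} (ξ : ℕ → X) (n : ℕ) : (pre ξ n).length = n := by simp [pre]

theorem getElem_pre {X : Type} (ξ : ℕ → X) {n i : ℕ} (h : i < (pre ξ n).length) :
    (pre ξ n)[i] = ξ i := by simp [pre]

/-- Two cylinders are either nested or disjoint. -/
theorem isPiSystem_cylinders (X : Type) :
    IsPiSystem (Set.range fun w : List X => {ξ : ℕ → X | pre ξ w.length = w}) := by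
  have key : ∀ v w : List X, v.length ≤ w.length →
      ({ξ : ℕ → X | pre ξ v.length = v} ∩ {ξ | pre ξ w.length = w}).Nonempty →
      {ξ : ℕ → X | pre ξ w.length = w} ⊆ {ξ | pre ξ v.length = v} := by
    rintro v w hvw ⟨ξ, hv, hw⟩ η hη
    have h1 := pre_prefix ξ hvw
    have h2 := pre_prefix η hvw
    rw [hv, hw] at h1
    rw [hη] at h2
    exact (List.prefix_of_prefix_length_le h2 h1 (by rw [length_pre])).eq_of_length
      (by rw [length_pre])
  rintro _ ⟨v, rfl⟩ _ ⟨w, rfl⟩ hne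
  rcases le_total v.length w.length with h | h
  · exact ⟨w, (Set.inter_eq_right.2 (key v w h hne)).symm⟩
  · exact ⟨v, (Set.inter_eq_left.2 (key w v h (by rwa [Set.inter_comm]))).symm⟩

theorem generateFrom_cylinders (X : Type) [Countable X] [MeasurableSpace X]
    [MeasurableSingletonClass X] :
    (MeasurableSpace.pi : MeasurableSpace (ℕ → X)) = MeasurableSpace.generateFrom
      (Set.range fun w : List X => {ξ : ℕ → X | pre ξ w.length = w}) := by
  apply le_antisymm
  · refine iSup_le fun n => ?_
    rintro _ ⟨T, -, rfl⟩
    -- The words of length `n + 1` with last letter in `T` form a countable set.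
    have : (fun ξ : ℕ → X => ξ n) ⁻¹' T =
        ⋃ w ∈ {w : List X | ∃ h : n < w.length, w[n] ∈ T ∧ w.length = n + 1},
          {ξ : ℕ → X | pre ξ w.length = w} := by
      ext ξ
      simp only [Set.mem_preimage, Set.mem_iUnion, Set.mem_ofPred_eq, exists_prop]
      constructor
      · intro h
        refine ⟨pre ξ (n + 1), ⟨by simp [pre], by rwa [getElem_pre], length_pre _ _⟩, ?_⟩
        rw [length_pre]
      · rintro ⟨w, ⟨h1, h2, -⟩, h3⟩
        have : (pre ξ w.length)[n]'(by rwa [length_pre]) = w[n] := by simp only [h3]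
        rw [← this] at h2
        simpa [pre] using h2
    rw [this]
    exact MeasurableSet.biUnion (Set.to_countable _) fun w _ =>
      MeasurableSpace.measurableSet_generateFrom ⟨w, rfl⟩
  · refine MeasurableSpace.generateFrom_le ?_
    rintro _ ⟨w, rfl⟩
    have : {ξ : ℕ → X | pre ξ w.length = w} = ⋂ i : Fin w.length, {ξ : ℕ → X | ξ i = w[i]} := by
      ext ξ
      simp only [Set.mem_ofPred_eq, Set.mem_iInter]
      constructor
      · intro h i
        have : (pre ξ w.length)[i]'(by rw [length_pre]; exact i.2) = w[i] := by simp only [h]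
        simpa [pre] using this
      · intro h
        refine List.ext_getElem (length_pre _ _) fun i h1 h2 => ?_
        simpa [pre] using h ⟨i, h2⟩
    change MeasurableSet {ξ : ℕ → X | pre ξ w.length = w}
    rw [this]
    exact MeasurableSet.iInter fun i => measurable_pi_apply _ (measurableSet_singleton _)

instance [NeZero d] : IsProbabilityMeasure (uniformOn (Set.univ : Set (ZMod d))) :=
  isProbabilityMeasure_uniformOn Set.finite_univ Set.univ_nonempty

instance [NeZero d] : IsProbabilityMeasure (bernoulliMeasure d) := by
  unfold bernoulliMeasure
  infer_instance

theorem bernoulliMeasure_cylinder [NeZero d] (w : List (ZMod d)) :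
    bernoulliMeasure d {ξ | pre ξ w.length = w} = ((d : ENNReal)⁻¹) ^ w.length := by
  have : {ξ : ℕ → ZMod d | pre ξ w.length = w} =
      Set.pi (Finset.range w.length) fun i => {w.getD i 0} := by
    ext ξ
    simp only [Set.mem_ofPred_eq, Set.mem_pi, Finset.coe_range, Set.mem_Iio, Set.mem_singleton_iff]
    constructor
    · intro h i hi
      have : (pre ξ w.length)[i]'(by rwa [length_pre]) = w[i] := by simp only [h]
      rw [List.getD_eq_getElem _ _ hi, ← this]
      simp [pre]
    · intro h
      refine List.ext_getElem (length_pre _ _) fun i h1 h2 => ?_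
      have := h i h2
      rw [List.getD_eq_getElem _ _ h2] at this
      simpa [pre] using this
  rw [this, bernoulliMeasure, Measure.infinitePi_pi _ fun i _ => measurableSet_singleton _]
  simp [uniformOn_univ, ZMod.card]

theorem preimage_cylinder {X : Type} (g : TreeAut X) (w : List X) :
    (fun ξ : ℕ → X => g • ξ) ⁻¹' {ξ | pre ξ w.length = w} =
      {ξ | pre ξ (g⁻¹.1 w).length = g⁻¹.1 w} := by
  have hlen : (g⁻¹.1 w).length = w.length := g⁻¹.2.1 w
  ext ξ
  rw [Set.mem_preimage, Set.mem_ofPred_eq, Set.mem_ofPred_eq, hlen]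
  have : pre (g • ξ) w.length = g.1 (pre ξ w.length) := pre_boundaryMap g ξ _
  rw [this]
  exact (Equiv.eq_symm_apply g.1).symm

/-- The preimage of a cylinder is a cylinder over a word of the same length, hence of the same
measure. -/
theorem measurePreserving_smul [NeZero d] (g : TreeAut (ZMod d)) :
    MeasurePreserving (fun ξ : ℕ → ZMod d => g • ξ) (bernoulliMeasure d) (bernoulliMeasure d) := by
  have hm : Measurable fun ξ : ℕ → ZMod d => g • ξ := by
    have hgen := generateFrom_cylinders (ZMod d)
    refine (measurable_generateFrom ?_).mono le_rfl hgen.le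
    rintro _ ⟨w, rfl⟩
    rw [preimage_cylinder, hgen]
    exact MeasurableSpace.measurableSet_generateFrom ⟨_, rfl⟩
  refine ⟨hm, ?_⟩
  have : IsProbabilityMeasure ((bernoulliMeasure d).map fun ξ : ℕ → ZMod d => g • ξ) :=
    Measure.isProbabilityMeasure_map hm.aemeasurable
  refine ext_of_generate_finite _ (generateFrom_cylinders (ZMod d))
    (isPiSystem_cylinders (ZMod d)) ?_ (by simp)
  rintro _ ⟨w, rfl⟩
  have hw : MeasurableSet {ξ : ℕ → ZMod d | pre ξ w.length = w} := by
    rw [generateFrom_cylinders]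
    exact MeasurableSpace.measurableSet_generateFrom ⟨w, rfl⟩
  rw [Measure.map_apply hm hw, preimage_cylinder, bernoulliMeasure_cylinder,
    bernoulliMeasure_cylinder]
  congr 1
  exact g⁻¹.2.1 w

theorem uniformOn_compl_singleton [NeZero d] (x : ZMod d) :
    uniformOn (Set.univ : Set (ZMod d)) {x}ᶜ = 1 - (d : ENNReal)⁻¹ := by
  rw [prob_compl_eq_one_sub (measurableSet_singleton x)]
  simp [uniformOn_univ, ZMod.card]

/-- Only the positions of zeros matter: each of the first `n` letters contributes a factor `1/d` or
`1 - 1/d`, so the measure is at most `q ^ n` with `q < 1`. -/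
theorem bernoulliMeasure_compClass [NeZero d] (hd : 3 ≤ d) (ξ : ℕ → ZMod d) :
    bernoulliMeasure d (compClass ξ) = 0 := by
  set q : ENNReal := max (d : ENNReal)⁻¹ (1 - (d : ENNReal)⁻¹) with hq
  have hd1 : (1 : ENNReal) < d := by exact_mod_cast (by omega : 1 < d)
  have hq1 : q < 1 := by
    refine max_lt (ENNReal.inv_lt_one.2 hd1) ?_
    exact ENNReal.sub_lt_self ENNReal.one_ne_top one_ne_zero
      (ENNReal.inv_ne_zero.2 (ENNReal.natCast_ne_top d))
  have hle : ∀ n, bernoulliMeasure d (compClass ξ) ≤ q ^ n := by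
    intro n
    have hsub : compClass ξ ⊆
        Set.pi (Finset.range n) fun i => {x : ZMod d | ξ i = 0 ↔ x = 0} :=
      fun η hη i _ => hη.1 i
    refine (measure_mono hsub).trans ?_
    rw [bernoulliMeasure, Measure.infinitePi_pi _ fun i _ => MeasurableSet.of_discrete]
    refine (Finset.prod_le_pow_card _ _ q fun i _ => ?_).trans (by simp)
    by_cases h : ξ i = 0
    · have : {x : ZMod d | ξ i = 0 ↔ x = 0} = {0} := by ext x; simp [h]
      rw [this, hq]
      refine le_max_of_le_left (le_of_eq ?_)
      simp [uniformOn_univ, ZMod.card]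
    · have : {x : ZMod d | ξ i = 0 ↔ x = 0} = {0}ᶜ := by ext x; simp [h]
      rw [this, hq, uniformOn_compl_singleton]
      exact le_max_right _ _
  exact le_antisymm
    (ge_of_tendsto' (ENNReal.tendsto_pow_atTop_nhds_zero_of_lt_one hq1) hle) zero_le

/-- The group is the image of the free product of `ℤ/dℤ` and `B`, which is a quotient of the words
over a finite alphabet. -/
theorem countable_spinalGroup [NeZero d] (ω : HomSeq d m) : Countable (spinalGroup ω) := by
  have h : spinalGroup ω = (Monoid.Coprod.lift (rotHom d) (spineHom ω)).range := by
    rw [Monoid.Coprod.range_lift, spinalGroup]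
    congr 1
    · ext g
      rw [mem_groupA, MonoidHom.mem_range]
      exact ⟨fun ⟨j, hj⟩ => ⟨Multiplicative.ofAdd j, hj.symm⟩, fun ⟨j, hj⟩ => ⟨j.toAdd, hj.symm⟩⟩
    · ext g
      rw [mem_groupB, MonoidHom.mem_range]
      exact ⟨fun ⟨j, hj⟩ => ⟨Multiplicative.ofAdd j, hj.symm⟩, fun ⟨j, hj⟩ => ⟨j.toAdd, hj.symm⟩⟩
  have : Countable (Multiplicative (ZMod d)) := inferInstanceAs (Countable (ZMod d))
  have : Countable (Multiplicative (Fin m → ZMod d)) :=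
    inferInstanceAs (Countable (Fin m → ZMod d))
  have : Countable (Monoid.Coprod (Multiplicative (ZMod d)) (Multiplicative (Fin m → ZMod d))) :=
    Monoid.Coprod.mk_surjective.countable
  rw [h]
  exact (MonoidHom.rangeRestrict_surjective _).countable

end Measure
end Spinal

theorem mainTheorem7 (d m : ℕ) [NeZero d] (hd : 3 ≤ d) (hm : 1 ≤ m)
    (ω : Spinal.HomSeq d m) (hω : ω ∈ Spinal.Omega d m) :
    Countable (Spinal.spinalGroup ω) ∧
    (∀ g ∈ Spinal.spinalGroup ω,
      MeasureTheory.MeasurePreserving (fun ξ : ℕ → ZMod d => g • ξ)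
        (Spinal.bernoulliMeasure d) (Spinal.bernoulliMeasure d)) ∧
    ∀ ξ : ℕ → ZMod d,
      Spinal.isoClass ω ξ = ⋃ g ∈ Spinal.spinalGroup ω, Spinal.compClass (g • ξ) ∧
      Spinal.bernoulliMeasure d (Spinal.isoClass ω ξ) = 0 := by
  refine ⟨Spinal.countable_spinalGroup ω, fun g _ => Spinal.measurePreserving_smul g,
    fun ξ => ⟨Spinal.isoClass_eq hd hω ξ, ?_⟩⟩
  have hc : (Spinal.spinalGroup ω : Set (Spinal.TreeAut (ZMod d))).Countable :=
    Set.countable_coe_iff.1 (Spinal.countable_spinalGroup ω)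
  rw [Spinal.isoClass_eq hd hω]
  exact (MeasureTheory.measure_biUnion_null_iff hc).2 fun g _ =>
    Spinal.bernoulliMeasure_compClass hd (g • ξ)
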